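/- For a sample $X_1,\dots,X_m\in\mathbb{R}$ and $0<p<1$, let $\theta_p(\{X_i\}_{i=1}^m)=\inf\{t\in\mathbb{R}:\hat F(t)\ge p\}$ denote the sample $p$-quantile, where $\hat F(t)=\frac1m\#\{i: X_i\le t\}$ is the empirical distribution function, and let $\|\cdot\|$ be the Euclidean norm on $\mathbb{R}^n$. There exist universal constants $c_0,c_1,c_2>0$ such that the following holds for all $m,n$. Let $\boldsymbol a_1,\dots,\boldsymbol a_m\in\mathbb{R}^n$ be random vectors all of whose $mn$ entries are i.i.d. $\mathcal N(0,1)$ random variables. If $m>c_0\,n\log n$, then with probability at least $1-c_1e^{-c_2m}$, simultaneously for all $\boldsymbol z,\boldsymbol x\in\mathbb{R}^n$ satisfying $\|\boldsymbol z-\boldsymbol x\|<\frac1{11}\|\boldsymbol z\|$ and for each $p\in\{0.49,\,0.5,\,0.51\}$, $$0.6\,\|\boldsymbol z\|\,\|\boldsymbol z-\boldsymbol x\|\;\le\;\theta_p\Big(\big\{\big||\boldsymbol a_i^T\boldsymbol x|^2-|\boldsymbol a_i^T\boldsymbol z|^2\big|\big\}_{i=1}^m\Big)\;\le\;\|\boldsymbol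 z\|\,\|\boldsymbol z-\boldsymbol x\|.$$ -/

import Mathlib

open MeasureTheory ProbabilityTheory

noncomputable section

/-- The generalized quantile function `F⁻¹(p) = inf {x ∈ ℝ : F(x) ≥ p}` of a cumulative
distribution function `F`. -/
def quantile (F : ℝ → ℝ) (p : ℝ) : ℝ :=
  sInf {x : ℝ | p ≤ F x}

/-- The cumulative distribution function of the empirical distribution of the samples
`X₁, …, X_m`: the fraction of the samples that are at most `x`. -/
def empiricalCDF {m : ℕ} (X : Fin m → ℝ) (x : ℝ) : ℝ :=
  ((Finset.univ.filter fun i : Fin m => X i ≤ x).card : ℝ) / (m : ℝ)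

/-- The sample `p`-quantile of `X₁, …, X_m`: the `p`-quantile of the empirical distribution. -/
def sampleQuantile {m : ℕ} (X : Fin m → ℝ) (p : ℝ) : ℝ :=
  quantile (empiricalCDF X) p

/-- The entries of the random vectors `a₁, …, a_m` in `ℝⁿ` are (jointly) independent
standard Gaussian random variables. -/
structure IsIIDStdGaussianEntries {Ω : Type*} [MeasurableSpace Ω] (P : Measure Ω) {m n : ℕ}
    (a : Fin m → Ω → EuclideanSpace ℝ (Fin n)) : Prop where
  hasLaw : ∀ i j, HasLaw (fun ω => a i ω j) (gaussianReal 0 1) P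
  indep : iIndepFun (fun (k : Fin m × Fin n) ω => a k.1 ω k.2) P

end

/-! ### Taylor bounds for the cosine -/

/-! Each sample factors: up to sign, `|aᵀx|² - |aᵀz|²` is `⟨a, z - x⟩⟨a, z + x⟩`. After normalising
both directions it equals `‖z - x‖ ‖z + x‖ |⟨a, u⟩⟨a, v⟩|` with unit `u`, `v`, and the hypothesis
puts `‖z + x‖` between `21/11 ‖z‖` and `23/11 ‖z‖`. It therefore suffices that, uniformly in unit
`u` and `v`, fewer than 49% of the products exceed `11/23` and fewer than 49% are at most `0.3147`,
a number above `0.6 · 11/21`. This is `ProductFrequencyBounds`, and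
`ProductFrequencyBounds.quantile_bounds` draws the conclusion.

For a fixed pair the law of the product depends only on `ρ = ⟨u, v⟩`. Polarisation writes the
product as a difference of squares of two independent Gaussians with variances `(1 ± ρ)/2`; polar
coordinates turn its tail into the one-dimensional integral `prodTail t ρ`
(`stdGaussian_inner_mul_inner`). The two-sided tail `prodTail t ρ + prodTail t (-ρ)` must be at most
`0.4898` for `t = 0.478` and at least `0.5102` for `t = 0.315`, for every `ρ ∈ [0, 1]`. Monotonicity
of `prodTail` in `ρ` reduces this to finitely many values, which Riemann sums in integer arithmetic
certify. For `t = 0.478` and `ρ` near `1` the product is almost a squared Gaussian, and a direct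
estimate of the normal distribution is used instead.

Hoeffding's inequality and a union bound over pairs from a net of the sphere (`exists_sphere_net`)
give the frequencies on the net. Rows with `‖a‖² ≤ 20000 n`, all but a fraction `0.0001` of them,
transfer these to all `u`, `v` (`productFrequencyBounds_of_net`). The logarithm of the number of
pairs is of order `n log n` up to a bounded term, which the condition on `m` and the constant `c₁`
absorb. -/

theorem nonneg_of_hasDerivAt_nonneg {f f' : ℝ → ℝ} (hf : ∀ x, HasDerivAt f (f' x) x)
    (h0 : 0 ≤ f 0) (h : ∀ x, 0 ≤ x → 0 ≤ f' x) {x : ℝ} (hx : 0 ≤ x) : 0 ≤ f x := by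
  have hm : MonotoneOn f (Set.Ici 0) := by
    refine monotoneOn_of_deriv_nonneg (convex_Ici 0)
      (fun y _ => (hf y).continuousAt.continuousWithinAt)
      (fun y _ => (hf y).differentiableAt.differentiableWithinAt) fun y hy => ?_
    rw [(hf y).deriv]
    exact h y (interior_subset hy)
  exact h0.trans (hm Set.self_mem_Ici hx hx)

/-- The Taylor polynomial of the cosine with `n` terms. -/
noncomputable def cosTaylor (n : ℕ) (x : ℝ) : ℝ :=
  ∑ k ∈ Finset.range n, (-1) ^ k * (x ^ (2 * k) / (2 * k).factorial)

/-- The Taylor polynomial of the sine with `n` terms. -/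
noncomputable def sinTaylor (n : ℕ) (x : ℝ) : ℝ :=
  ∑ k ∈ Finset.range n, (-1) ^ k * (x ^ (2 * k + 1) / (2 * k + 1).factorial)

theorem hasDerivAt_pow_div_factorial (k : ℕ) (x : ℝ) :
    HasDerivAt (fun y : ℝ => y ^ (k + 1) / (k + 1).factorial) (x ^ k / k.factorial) x := by
  refine ((hasDerivAt_pow (k + 1) x).div_const _).congr_deriv ?_
  rw [Nat.factorial_succ]
  have : (k.factorial : ℝ) ≠ 0 := by positivity
  push_cast
  field_simp

theorem hasDerivAt_sinTaylor (n : ℕ) (x : ℝ) :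
    HasDerivAt (sinTaylor n) (cosTaylor n x) x := by
  unfold sinTaylor cosTaylor
  exact HasDerivAt.fun_sum fun k _ => (hasDerivAt_pow_div_factorial (2 * k) x).const_mul _

theorem hasDerivAt_cosTaylor (n : ℕ) (x : ℝ) :
    HasDerivAt (cosTaylor (n + 1)) (-sinTaylor n x) x := by
  have h : cosTaylor (n + 1) = fun y => (∑ k ∈ Finset.range n,
      (-1 : ℝ) ^ (k + 1) * (y ^ (2 * k + 1 + 1) / (2 * k + 1 + 1).factorial)) + 1 := by
    funext y
    simp [cosTaylor, Finset.sum_range_succ', mul_add]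
  rw [h, sinTaylor, ← Finset.sum_neg_distrib]
  refine (HasDerivAt.fun_sum fun k _ => ?_).add_const _
  exact ((hasDerivAt_pow_div_factorial (2 * k + 1) x).const_mul _).congr_deriv (by ring)

/-- Induction by alternate integration: each remainder has the other function's remainder, up to
sign, as its derivative, so the sign on `[0, ∞)` passes from cosine to sine and back. The start is
`cos ≤ 1`. -/
theorem cosTaylor_sinTaylor_sign (n : ℕ) :
    (∀ x, 0 ≤ x → 0 ≤ (-1) ^ (n + 1) * (Real.cos x - cosTaylor (n + 1) x)) ∧
      ∀ x, 0 ≤ x → 0 ≤ (-1) ^ (n + 1) * (Real.sin x - sinTaylor (n + 1) x) := by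
  have key : ∀ n, (∀ x, 0 ≤ x → 0 ≤ (-1) ^ (n + 1) * (Real.cos x - cosTaylor (n + 1) x)) →
      ∀ x, 0 ≤ x → 0 ≤ (-1) ^ (n + 1) * (Real.sin x - sinTaylor (n + 1) x) := by
    intro n hn x hx
    refine nonneg_of_hasDerivAt_nonneg (fun y =>
      ((Real.hasDerivAt_sin y).sub (hasDerivAt_sinTaylor (n + 1) y)).const_mul _) ?_ hn hx
    simp [sinTaylor]
  induction n with
  | zero =>
    have h : ∀ x, 0 ≤ x → 0 ≤ (-1) ^ (0 + 1) * (Real.cos x - cosTaylor (0 + 1) x) := by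
      intro x _
      have := Real.cos_le_one x
      simp [cosTaylor]
      linarith
    exact ⟨h, key 0 h⟩
  | succ n ih =>
    have h : ∀ x, 0 ≤ x →
        0 ≤ (-1) ^ (n + 1 + 1) * (Real.cos x - cosTaylor (n + 1 + 1) x) := by
      intro x hx
      refine nonneg_of_hasDerivAt_nonneg (fun y =>
        ((Real.hasDerivAt_cos y).sub (hasDerivAt_cosTaylor (n + 1) y)).const_mul _) ?_
        (fun y hy => ?_) hx
      · simp [cosTaylor, Finset.sum_range_succ']
      · have := ih.2 y hy
        rw [pow_succ]
        linarith
    exact ⟨h, key (n + 1) h⟩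

/-! ### Fixed-point bounds for the cosine and the exponential

All quantities are integers in units of `10⁻⁶`, so that the bounds evaluate quickly by reduction. -/

/-- `∑ k < n, g k`, in a form that evaluates by reduction. -/
def partialSum (g : ℕ → ℕ) : ℕ → ℕ
  | 0 => 0
  | n + 1 => partialSum g n + g n

theorem partialSum_eq (g : ℕ → ℕ) (n : ℕ) : partialSum g n = ∑ k ∈ Finset.range n, g k := by
  induction n with
  | zero => rfl
  | succ n ih => rw [partialSum, ih, Finset.sum_range_succ]

/-- `16! * B ^ 8` times the Taylor polynomial of degree `16` of the cosine at `√(A / B)`. -/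
def cosNumUp (A B : ℤ) : ℤ :=
  20922789888000 * B ^ 8 - 10461394944000 * A * B ^ 7 + 871782912000 * A ^ 2 * B ^ 6 -
    29059430400 * A ^ 3 * B ^ 5 + 518918400 * A ^ 4 * B ^ 4 - 5765760 * A ^ 5 * B ^ 3 +
    43680 * A ^ 6 * B ^ 2 - 240 * A ^ 7 * B + A ^ 8

/-- `14! * B ^ 7` times the Taylor polynomial of degree `14` of the cosine at `√(A / B)`. -/
def cosNumDown (A B : ℤ) : ℤ :=
  87178291200 * B ^ 7 - 43589145600 * A * B ^ 6 + 3632428800 * A ^ 2 * B ^ 5 -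
    121080960 * A ^ 3 * B ^ 4 + 2162160 * A ^ 4 * B ^ 3 - 24024 * A ^ 5 * B ^ 2 +
    182 * A ^ 6 * B - A ^ 7

theorem cos_le_cosNumUp {a b : ℕ} (hb : 0 < b) :
    Real.cos (a / b) ≤
      (cosNumUp ((a : ℤ) ^ 2) ((b : ℤ) ^ 2) : ℝ) / (20922789888000 * ((b : ℝ) ^ 2) ^ 8) := by
  have hb' : (0 : ℝ) < b := by exact_mod_cast hb
  have h := (cosTaylor_sinTaylor_sign 8).1 (a / b) (by positivity)
  have e : (cosNumUp ((a : ℤ) ^ 2) ((b : ℤ) ^ 2) : ℝ) / (20922789888000 * ((b : ℝ) ^ 2) ^ 8) =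
      cosTaylor 9 (a / b) := by
    simp only [cosTaylor, Finset.sum_range_succ, Finset.sum_range_zero, cosNumUp, Nat.factorial]
    push_cast
    field_simp
    ring
  rw [e]
  norm_num at h
  linarith

theorem cosNumDown_le_cos {a b : ℕ} (hb : 0 < b) :
    (cosNumDown ((a : ℤ) ^ 2) ((b : ℤ) ^ 2) : ℝ) / (87178291200 * ((b : ℝ) ^ 2) ^ 7) ≤
      Real.cos (a / b) := by
  have hb' : (0 : ℝ) < b := by exact_mod_cast hb
  have h := (cosTaylor_sinTaylor_sign 7).1 (a / b) (by positivity)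
  have e : (cosNumDown ((a : ℤ) ^ 2) ((b : ℤ) ^ 2) : ℝ) / (87178291200 * ((b : ℝ) ^ 2) ^ 7) =
      cosTaylor 8 (a / b) := by
    simp only [cosTaylor, Finset.sum_range_succ, Finset.sum_range_zero, cosNumDown, Nat.factorial]
    push_cast
    field_simp
    ring
  rw [e]
  norm_num at h
  linarith

/-- An upper bound for `cos (k π / N)`. -/
def cosUp (N k : ℕ) : ℤ :=
  10 ^ 6 * cosNumUp (((31415 * k : ℕ) : ℤ) ^ 2) (((10000 * N : ℕ) : ℤ) ^ 2) /
    (20922789888000 * (((10000 * N : ℕ) : ℤ) ^ 2) ^ 8) + 1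

/-- A lower bound for `cos (k π / N)`. -/
def cosDown (N k : ℕ) : ℤ :=
  10 ^ 6 * cosNumDown (((31416 * k : ℕ) : ℤ) ^ 2) (((10000 * N : ℕ) : ℤ) ^ 2) /
    (87178291200 * (((10000 * N : ℕ) : ℤ) ^ 2) ^ 7)

theorem div_le_intDiv_add_one (x : ℤ) {d : ℤ} (hd : 0 < d) :
    (x : ℝ) / d ≤ ((x / d + 1 : ℤ) : ℝ) := by
  have hd' : (0 : ℝ) < d := by exact_mod_cast hd
  rw [div_le_iff₀ hd']
  exact_mod_cast (Int.lt_ediv_add_one_mul_self x hd).le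

theorem intDiv_le_div (x : ℤ) {d : ℤ} (hd : 0 < d) : ((x / d : ℤ) : ℝ) ≤ (x : ℝ) / d := by
  have hd' : (0 : ℝ) < d := by exact_mod_cast hd
  rw [le_div_iff₀ hd']
  exact_mod_cast Int.ediv_mul_le x hd.ne'

theorem cos_le_cosUp {N k : ℕ} (hN : 0 < N) (hk : k ≤ N) :
    Real.cos (k * (Real.pi / N)) ≤ cosUp N k / 10 ^ 6 := by
  have hN' : (0 : ℝ) < N := by exact_mod_cast hN
  have hk' : (k : ℝ) ≤ N := by exact_mod_cast hk
  have hpi := Real.pi_gt_d4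
  norm_num at hpi
  -- The cosine decreases on `[0, π]`, so rounding `π` down to `3.1415` gives an upper bound.
  have h1 : Real.cos (k * (Real.pi / N)) ≤ Real.cos ((31415 * k : ℕ) / (10000 * N : ℕ)) := by
    refine Real.cos_le_cos_of_nonneg_of_le_pi (by positivity) ?_ ?_
    · rw [← mul_div_assoc, div_le_iff₀ hN', mul_comm]
      gcongr
    · push_cast
      rw [← mul_div_assoc, div_le_div_iff₀ (by positivity) hN']
      have : (0 : ℝ) ≤ k * N := by positivity
      nlinarith
  refine h1.trans ((cos_le_cosNumUp (by positivity)).trans ?_)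
  have h2 := div_le_intDiv_add_one
    (10 ^ 6 * cosNumUp (((31415 * k : ℕ) : ℤ) ^ 2) (((10000 * N : ℕ) : ℤ) ^ 2))
    (d := 20922789888000 * (((10000 * N : ℕ) : ℤ) ^ 2) ^ 8) (by positivity)
  rw [le_div_iff₀ (by positivity), cosUp]
  refine le_trans (le_of_eq ?_) h2
  rw [Int.cast_mul, mul_comm, ← mul_div_assoc]
  norm_num

theorem cosDown_le_cos {N k : ℕ} (hk : k < N) (hN : N ≤ 1000) :
    (cosDown N k : ℝ) / 10 ^ 6 ≤ Real.cos (k * (Real.pi / N)) := by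
  have hN0 : 0 < N := (Nat.zero_le k).trans_lt hk
  have hN' : (0 : ℝ) < N := by exact_mod_cast hN0
  have hN2 : (N : ℝ) ≤ 1000 := by exact_mod_cast hN
  have hk' : (k : ℝ) + 1 ≤ N := by exact_mod_cast hk
  have hpi := Real.pi_lt_d4
  have hpi' := Real.pi_gt_d4
  norm_num at hpi hpi'
  have h1 : Real.cos ((31416 * k : ℕ) / (10000 * N : ℕ)) ≤ Real.cos (k * (Real.pi / N)) := by
    refine Real.cos_le_cos_of_nonneg_of_le_pi (by positivity) ?_ ?_
    · push_cast
      -- Here `π` is rounded up to `3.1416`; the argument must still not exceed `π`, which is where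
      -- `k < N` and `N ≤ 1000` enter.
      rw [div_le_iff₀ (by positivity)]
      nlinarith
    · push_cast
      rw [← mul_div_assoc, div_le_div_iff₀ hN' (by positivity)]
      have : (0 : ℝ) ≤ k * N := by positivity
      nlinarith
  refine le_trans ?_ ((cosNumDown_le_cos (by positivity)).trans h1)
  have h2 := intDiv_le_div
    (10 ^ 6 * cosNumDown (((31416 * k : ℕ) : ℤ) ^ 2) (((10000 * N : ℕ) : ℤ) ^ 2))
    (d := 87178291200 * (((10000 * N : ℕ) : ℤ) ^ 2) ^ 7) (by positivity)
  rw [div_le_iff₀ (by positivity), cosDown]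
  refine h2.trans (le_of_eq ?_)
  rw [Int.cast_mul, mul_comm, mul_div_right_comm]
  norm_num

/-- `exp (-t / s)` for `s > 0`, extended by `0` to `s ≤ 0`. -/
noncomputable def expNegDiv (t s : ℝ) : ℝ := if 0 < s then Real.exp (-(t / s)) else 0

theorem expNegDiv_nonneg (t s : ℝ) : 0 ≤ expNegDiv t s := by
  unfold expNegDiv
  split_ifs <;> positivity

theorem expNegDiv_le_one {t : ℝ} (ht : 0 ≤ t) (s : ℝ) : expNegDiv t s ≤ 1 := by
  unfold expNegDiv
  split_ifs with h
  · rw [Real.exp_le_one_iff]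
    have : 0 ≤ t / s := by positivity
    linarith
  · exact zero_le_one

theorem expNegDiv_mono {t : ℝ} (ht : 0 ≤ t) : Monotone (expNegDiv t) := by
  intro a b hab
  by_cases ha : 0 < a
  · have hb : 0 < b := ha.trans_le hab
    simp only [expNegDiv, ha, hb, if_true]
    gcongr
  · have : expNegDiv t a = 0 := by simp [expNegDiv, ha]
    rw [this]
    exact expNegDiv_nonneg t b

/-- An upper bound for `expNegDiv (T / 10 ^ 6) (S / 10 ^ 6)`. -/
def expUp (T : ℕ) (S : ℤ) : ℕ :=
  if S ≤ 0 then 0 else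
    10 ^ 6 * (6 * (8 * S.toNat) ^ 3) ^ 8 /
      (6 * (8 * S.toNat) ^ 3 + 6 * (8 * S.toNat) ^ 2 * T + 3 * (8 * S.toNat) * T ^ 2 +
        T ^ 3) ^ 8 + 1

/-- A lower bound for `expNegDiv (T / 10 ^ 6) (S / 10 ^ 6)`. -/
def expDown (T : ℕ) (S : ℤ) : ℕ :=
  if 8 * S ≤ T then 0 else
    10 ^ 6 * (18 * (8 * S.toNat) ^ 3) ^ 8 /
      (18 * (8 * S.toNat) ^ 3 + 18 * (8 * S.toNat) ^ 2 * T + 9 * (8 * S.toNat) * T ^ 2 +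
        4 * T ^ 3) ^ 8

/-- Scaling the argument down by `8` and taking an eighth power makes cubic polynomials accurate
enough. -/
theorem exp_neg_div_eq {T S : ℝ} (hS : 0 < S) :
    Real.exp (-(T / 10 ^ 6 / (S / 10 ^ 6))) = 1 / Real.exp (T / (8 * S)) ^ 8 := by
  rw [← Real.exp_nat_mul, one_div, ← Real.exp_neg]
  congr 2
  field_simp
  norm_num

theorem expNegDiv_le_expUp (T : ℕ) (S : ℤ) :
    expNegDiv (T / 10 ^ 6) (S / 10 ^ 6) ≤ expUp T S / 10 ^ 6 := by
  unfold expUp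
  rcases le_or_gt S 0 with hS | hS
  · have hS' : (S : ℝ) ≤ 0 := by exact_mod_cast hS
    have : ¬ (0 : ℝ) < S / 10 ^ 6 := not_lt.2 (div_nonpos_of_nonpos_of_nonneg hS' (by positivity))
    simp [expNegDiv, this, hS]
  · lift S to ℕ using hS.le
    have hS' : (0 : ℝ) < S := by exact_mod_cast hS
    rw [if_neg (not_le.2 hS), expNegDiv, if_pos (by push_cast; positivity), Int.toNat_natCast,
      Int.cast_natCast, exp_neg_div_eq hS', le_div_iff₀ (by positivity)]
    have hdiv : ∀ x d : ℕ, 0 < d → (x : ℝ) / d ≤ ((x / d + 1 : ℕ) : ℝ) := by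
      intro x d hd
      rw [div_le_iff₀ (by exact_mod_cast hd), mul_comm]
      exact_mod_cast (Nat.lt_mul_div_succ x hd).le
    refine le_trans ?_ (hdiv _ _ (by
      have : 0 < S := by exact_mod_cast hS
      positivity))
    have hy0 : (0 : ℝ) ≤ T / (8 * S) := by positivity
    have h := Real.sum_le_exp_of_nonneg hy0 4
    simp only [Finset.sum_range_succ, Finset.sum_range_zero, Nat.factorial] at h
    norm_num at h
    set y : ℝ := T / (8 * S) with hy
    have hT : (T : ℝ) = y * (8 * S) := by rw [hy]; field_simp
    calc 1 / Real.exp y ^ 8 * 10 ^ 6 ≤ 1 / (1 + y + y ^ 2 / 2 + y ^ 3 / 6) ^ 8 * 10 ^ 6 := by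
          gcongr
      _ = _ := by
          push_cast
          rw [hT, show 6 * (8 * (S : ℝ)) ^ 3 + 6 * (8 * S) ^ 2 * (y * (8 * S)) +
            3 * (8 * S) * (y * (8 * S)) ^ 2 + (y * (8 * S)) ^ 3 =
              (6 * (8 * S) ^ 3) * (1 + y + y ^ 2 / 2 + y ^ 3 / 6) by ring, mul_pow]
          have : (1 + y + y ^ 2 / 2 + y ^ 3 / 6) ^ 8 ≠ 0 := by positivity
          field_simp
          norm_num

theorem expDown_le_expNegDiv (T : ℕ) (S : ℤ) :
    (expDown T S : ℝ) / 10 ^ 6 ≤ expNegDiv (T / 10 ^ 6) (S / 10 ^ 6) := by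
  unfold expDown
  rcases le_or_gt (8 * S) T with hST | hST
  · simpa [hST] using expNegDiv_nonneg _ _
  · have hS : 0 < S := by omega
    lift S to ℕ using hS.le
    have hS' : (0 : ℝ) < S := by exact_mod_cast hS
    have hST' : (T : ℝ) < 8 * S := by exact_mod_cast hST
    rw [if_neg (not_le.2 hST), expNegDiv, if_pos (by push_cast; positivity), Int.toNat_natCast,
      Int.cast_natCast, exp_neg_div_eq hS', div_le_iff₀ (by positivity)]
    refine Nat.cast_div_le.trans ?_
    have hy0 : (0 : ℝ) ≤ T / (8 * S) := by positivity
    -- The upper Taylor estimate of `exp` needs an argument at most `1`; this is why `expDown`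
    -- returns `0` when `8 * S ≤ T`.
    have hy1 : (T / (8 * S) : ℝ) ≤ 1 := by rw [div_le_one (by positivity)]; exact hST'.le
    have h := Real.exp_bound' hy0 hy1 (n := 3) (by norm_num)
    simp only [Finset.sum_range_succ, Finset.sum_range_zero, Nat.factorial] at h
    norm_num at h
    set y : ℝ := T / (8 * S) with hy
    have hT : (T : ℝ) = y * (8 * S) := by rw [hy]; field_simp
    have h2 : Real.exp y ≤ 1 + y + y ^ 2 / 2 + 2 * y ^ 3 / 9 := by linarith
    calc _ = 1 / (1 + y + y ^ 2 / 2 + 2 * y ^ 3 / 9) ^ 8 * 10 ^ 6 := by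
          push_cast
          rw [hT, show 18 * (8 * (S : ℝ)) ^ 3 + 18 * (8 * S) ^ 2 * (y * (8 * S)) +
            9 * (8 * S) * (y * (8 * S)) ^ 2 + 4 * (y * (8 * S)) ^ 3 =
              (18 * (8 * S) ^ 3) * (1 + y + y ^ 2 / 2 + 2 * y ^ 3 / 9) by ring, mul_pow]
          have : (1 + y + y ^ 2 / 2 + 2 * y ^ 3 / 9) ^ 8 ≠ 0 := by positivity
          field_simp
          norm_num
      _ ≤ 1 / Real.exp y ^ 8 * 10 ^ 6 := by gcongr

/-! ### Riemann sums -/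

/-- The mean of `exp (-t / (cos φ + ρ))⁺` over `φ ∈ [0, π]`: the probability that the product of two
standard Gaussian variables of correlation `ρ` exceeds `t`. -/
noncomputable def prodTail (t ρ : ℝ) : ℝ :=
  (∫ φ in (0 : ℝ)..Real.pi, expNegDiv t (Real.cos φ + ρ)) / Real.pi

theorem prodTail_eq {t : ℝ} {N : ℕ} (hN : 0 < N) (ρ : ℝ) :
    prodTail t ρ =
      (∫ x in (0 : ℝ)..(0 + N), expNegDiv t (Real.cos (x * (Real.pi / N)) + ρ)) / N := by
  have hpi := Real.pi_pos
  have hN' : (0 : ℝ) < N := by exact_mod_cast hN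
  rw [intervalIntegral.integral_comp_mul_right (fun φ => expNegDiv t (Real.cos φ + ρ))
    (by positivity : Real.pi / N ≠ 0), prodTail]
  have : (0 + (N : ℝ)) * (Real.pi / N) = Real.pi := by field_simp; ring
  rw [this, zero_mul, smul_eq_mul]
  field_simp

/-- Monotonicity brackets the integral between its left and right Riemann sums, so no modulus of
continuity is needed. -/
theorem antitoneOn_expNegDiv_cos {t : ℝ} (ht : 0 ≤ t) {N : ℕ} (hN : 0 < N) (ρ : ℝ) :
    AntitoneOn (fun x : ℝ => expNegDiv t (Real.cos (x * (Real.pi / N)) + ρ))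
      (Set.Icc 0 (0 + N)) := by
  have hpi := Real.pi_pos
  have hN' : (0 : ℝ) < N := by exact_mod_cast hN
  intro x hx y hy hxy
  refine expNegDiv_mono ht (add_le_add ?_ le_rfl)
  refine Real.cos_le_cos_of_nonneg_of_le_pi (mul_nonneg hx.1 (by positivity)) ?_ (by gcongr)
  calc y * (Real.pi / N) ≤ N * (Real.pi / N) := by
        have := hy.2
        gcongr
        linarith
    _ = Real.pi := by field_simp

theorem intervalIntegrable_expNegDiv_cos {t : ℝ} (ht : 0 ≤ t) (ρ : ℝ) :
    IntervalIntegrable (fun φ => expNegDiv t (Real.cos φ + ρ)) volume 0 Real.pi := by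
  have h' : AntitoneOn (fun φ => expNegDiv t (Real.cos φ + ρ)) (Set.uIcc 0 Real.pi) := by
    rw [Set.uIcc_of_le Real.pi_pos.le]
    intro x hx y hy hxy
    exact expNegDiv_mono ht (add_le_add
      (Real.cos_le_cos_of_nonneg_of_le_pi hx.1 hy.2 hxy) le_rfl)
  exact h'.intervalIntegrable

theorem prodTail_mono {t : ℝ} (ht : 0 ≤ t) : Monotone (prodTail t) := by
  intro a b hab
  unfold prodTail
  refine div_le_div_of_nonneg_right ?_ Real.pi_pos.le
  exact intervalIntegral.integral_mono_on Real.pi_pos.le (intervalIntegrable_expNegDiv_cos ht a)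
    (intervalIntegrable_expNegDiv_cos ht b)
    fun φ _ => expNegDiv_mono ht (add_le_add le_rfl hab)

/-- An upper bound for `N * prodTail (T / 10 ^ 6) (R / 10 ^ 6)` in units of `10⁻⁶`. -/
def tailUp (N T : ℕ) (R : ℤ) : ℕ := partialSum (fun k => expUp T (cosUp N k + R)) N

/-- A lower bound for `N * prodTail (T / 10 ^ 6) (R / 10 ^ 6)` in units of `10⁻⁶`. -/
def tailDown (N T : ℕ) (R : ℤ) : ℕ :=
  partialSum (fun k => expDown T (cosDown N (k + 1) + R)) (N - 1)

theorem prodTail_le_tailUp {N : ℕ} (hN : 0 < N) (T : ℕ) (R : ℤ) :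
    prodTail (T / 10 ^ 6) (R / 10 ^ 6) ≤ tailUp N T R / (10 ^ 6 * N) := by
  have ht : (0 : ℝ) ≤ T / 10 ^ 6 := by positivity
  rw [prodTail_eq hN, tailUp, partialSum_eq, ← div_div]
  refine div_le_div_of_nonneg_right ?_ (by positivity)
  rw [Nat.cast_sum, Finset.sum_div]
  refine (antitoneOn_expNegDiv_cos ht hN _).integral_le_sum.trans
    (Finset.sum_le_sum fun k hk => ?_)
  refine le_trans (expNegDiv_mono ht ?_) (expNegDiv_le_expUp T _)
  push_cast
  rw [zero_add, add_div]
  exact add_le_add (cos_le_cosUp hN (Finset.mem_range.1 hk).le) le_rfl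

theorem tailDown_le_prodTail {N : ℕ} (hN : 0 < N) (hN' : N ≤ 1000) (T : ℕ) (R : ℤ) :
    (tailDown N T R : ℝ) / (10 ^ 6 * N) ≤ prodTail (T / 10 ^ 6) (R / 10 ^ 6) := by
  have ht : (0 : ℝ) ≤ T / 10 ^ 6 := by positivity
  rw [prodTail_eq hN, tailDown, partialSum_eq, ← div_div]
  refine div_le_div_of_nonneg_right ?_ (by positivity)
  rw [Nat.cast_sum, Finset.sum_div]
  refine le_trans ?_ (antitoneOn_expNegDiv_cos ht hN _).sum_le_integral
  -- The right end point `φ = π` is dropped from the lower sum: its term is nonnegative, and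
  -- `cosDown_le_cos` requires `k < N`.
  refine (Finset.sum_le_sum (g := fun k : ℕ => expNegDiv (T / 10 ^ 6)
    (Real.cos ((0 + ((k + 1 : ℕ) : ℝ)) * (Real.pi / N)) + R / 10 ^ 6)) fun k hk => ?_).trans
    (Finset.sum_le_sum_of_subset_of_nonneg (Finset.range_mono (Nat.sub_le N 1))
      fun k _ _ => expNegDiv_nonneg _ _)
  refine (expDown_le_expNegDiv T _).trans (expNegDiv_mono ht ?_)
  have hk' : k + 1 < N := by have := Finset.mem_range.1 hk; omega
  rw [zero_add, Int.cast_add, add_div]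
  exact add_le_add (cosDown_le_cos hk' hN') le_rfl

/-! ### Certification on a grid of correlations -/

/-- `tailUp` at the end points of each interval of the grid certifies `C` on the whole grid. -/
def checkUp (N T C : ℕ) : ℤ → List ℤ → Bool
  | _, [] => true
  | a, b :: l => decide (tailUp N T b + tailUp N T (-a) ≤ C * N) && checkUp N T C b l

/-- `tailDown` at the end points of each interval of the grid certifies `C` on the whole grid. -/
def checkDown (N T C : ℕ) : ℤ → List ℤ → Bool
  | _, [] => true
  | a, b :: l => decide (C * N ≤ tailDown N T a + tailDown N T (-b)) && checkDown N T C b l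

/-- For `ρ ∈ [a, b]` the two tails are at most their values at `b` and at `-a`, since `prodTail`
increases in its correlation. -/
theorem le_of_checkUp {N T C : ℕ} (hN : 0 < N) (l : List ℤ) (a : ℤ)
    (h : checkUp N T C a l) {ρ : ℝ} (h1 : a / 10 ^ 6 ≤ ρ)
    (h2 : ρ ≤ (l.getLastD a : ℤ) / 10 ^ 6) (hl : l ≠ []) :
    prodTail (T / 10 ^ 6) ρ + prodTail (T / 10 ^ 6) (-ρ) ≤ C / 10 ^ 6 := by
  have ht : (0 : ℝ) ≤ T / 10 ^ 6 := by positivity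
  have hN' : (0 : ℝ) < N := by exact_mod_cast hN
  induction l generalizing a with
  | nil => exact absurd rfl hl
  | cons b l ih =>
    simp only [checkUp, Bool.and_eq_true, decide_eq_true_eq] at h
    have step : ρ ≤ b / 10 ^ 6 →
        prodTail (T / 10 ^ 6) ρ + prodTail (T / 10 ^ 6) (-ρ) ≤ C / 10 ^ 6 := by
      intro hb
      have e1 := (prodTail_mono ht hb).trans (prodTail_le_tailUp hN T b)
      have e2 := (prodTail_mono ht (neg_le_neg h1)).trans
        (le_of_eq_of_le (by push_cast; rw [neg_div]) (prodTail_le_tailUp hN T (-a)))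
      have e3 : (tailUp N T b : ℝ) + tailUp N T (-a) ≤ C * N := by exact_mod_cast h.1
      refine (add_le_add e1 e2).trans ?_
      rw [← add_div, div_le_div_iff₀ (by positivity) (by positivity)]
      nlinarith
    rcases le_total ρ (b / 10 ^ 6) with hb | hb
    · exact step hb
    · rcases l with _ | ⟨b', l⟩
      · exact step (by simpa using h2)
      · exact ih b h.2 hb h2 (by simp)

theorem ge_of_checkDown {N T C : ℕ} (hN : 0 < N) (hN1 : N ≤ 1000) (l : List ℤ) (a : ℤ)
    (h : checkDown N T C a l) {ρ : ℝ} (h1 : a / 10 ^ 6 ≤ ρ)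
    (h2 : ρ ≤ (l.getLastD a : ℤ) / 10 ^ 6) (hl : l ≠ []) :
    C / 10 ^ 6 ≤ prodTail (T / 10 ^ 6) ρ + prodTail (T / 10 ^ 6) (-ρ) := by
  have ht : (0 : ℝ) ≤ T / 10 ^ 6 := by positivity
  have hN' : (0 : ℝ) < N := by exact_mod_cast hN
  induction l generalizing a with
  | nil => exact absurd rfl hl
  | cons b l ih =>
    simp only [checkDown, Bool.and_eq_true, decide_eq_true_eq] at h
    have step : ρ ≤ b / 10 ^ 6 →
        C / 10 ^ 6 ≤ prodTail (T / 10 ^ 6) ρ + prodTail (T / 10 ^ 6) (-ρ) := by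
      intro hb
      have e1 := (tailDown_le_prodTail hN hN1 T a).trans (prodTail_mono ht h1)
      have e2 := (tailDown_le_prodTail hN hN1 T (-b)).trans
        (le_of_eq_of_le (by push_cast; rw [neg_div]) (prodTail_mono ht (neg_le_neg hb)))
      have e3 : (C : ℝ) * N ≤ tailDown N T a + tailDown N T (-b) := by exact_mod_cast h.1
      refine le_trans ?_ (add_le_add e1 e2)
      rw [← add_div, div_le_div_iff₀ (by positivity) (by positivity)]
      nlinarith
    rcases le_total ρ (b / 10 ^ 6) with hb | hb
    · exact step hb
    · rcases l with _ | ⟨b', l⟩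
      · exact step (by simpa using h2)
      · exact ih b h.2 hb h2 (by simp)

theorem prodTail_add_prodTail_neg_le_of_le {ρ : ℝ} (h0 : 0 ≤ ρ) (h1 : ρ ≤ 0.94) :
    prodTail 0.478 ρ + prodTail 0.478 (-ρ) ≤ 0.4898 := by
  have h := le_of_checkUp (N := 64) (T := 478000) (C := 489800) (by norm_num)
    [210000, 420000, 630000, 830000, 940000] 0 (by decide +kernel) (ρ := ρ) (by simpa using h0)
    (by norm_num at h1 ⊢; exact h1) (by simp)
  norm_num at h ⊢
  exact h

theorem le_prodTail_add_prodTail_neg {ρ : ℝ} (h0 : 0 ≤ ρ) (h1 : ρ ≤ 1) :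
    0.5102 ≤ prodTail 0.315 ρ + prodTail 0.315 (-ρ) := by
  have h := ge_of_checkDown (N := 128) (T := 315000) (C := 510200) (by norm_num) (by norm_num)
    [83000, 164000, 241000, 312000, 377000, 436000, 488000, 535000, 577000, 615000, 649000, 681000,
      712000, 743000, 776000, 816000, 883000, 1000000] 0 (by decide +kernel) (ρ := ρ)
    (by simpa using h0) (by norm_num at h1 ⊢; exact h1) (by simp)
  norm_num at h ⊢
  exact h

/-! ### Products of two linear forms of a standard Gaussian vector -/

theorem measurable_expNegDiv (t : ℝ) : Measurable (expNegDiv t) := by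
  unfold expNegDiv
  exact Measurable.ite measurableSet_Ioi (by fun_prop) measurable_const

/-- As `θ` runs over `[-π, π]`, the angle `2θ` covers two periods, and evenness of the cosine folds
each period onto `[0, π]` twice. -/
theorem integral_expNegDiv_cos_two_mul {t : ℝ} (ht : 0 ≤ t) (ρ : ℝ) :
    ∫ θ in (-Real.pi)..Real.pi, expNegDiv t (Real.cos (2 * θ) + ρ) =
      2 * (Real.pi * prodTail t ρ) := by
  set g : ℝ → ℝ := fun φ => expNegDiv t (Real.cos φ + ρ) with hg
  have hpi := Real.pi_pos
  have hint : ∀ a b : ℝ, IntervalIntegrable g volume a b := by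
    intro a b
    refine (intervalIntegrable_const (c := (1 : ℝ))).mono_fun ?_ ?_
    · exact ((measurable_expNegDiv t).comp (by fun_prop)).aestronglyMeasurable
    · refine Filter.Eventually.of_forall fun φ => ?_
      change ‖expNegDiv t (Real.cos φ + ρ)‖ ≤ ‖(1 : ℝ)‖
      rw [Real.norm_of_nonneg (expNegDiv_nonneg _ _)]
      simpa using expNegDiv_le_one ht _
  have hper : Function.Periodic g (2 * Real.pi) := fun φ => by simp [hg]
  have heven : ∫ φ in (-Real.pi)..0, g φ = ∫ φ in (0 : ℝ)..Real.pi, g φ := by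
    have := intervalIntegral.integral_comp_neg (f := g) (a := 0) (b := Real.pi)
    rw [neg_zero] at this
    rw [← this]
    exact intervalIntegral.integral_congr fun φ _ => by simp [hg]
  have h0 : ∫ φ in (0 : ℝ)..Real.pi, g φ = Real.pi * prodTail t ρ := by
    rw [prodTail]
    field_simp
    rfl
  have h1 : ∫ φ in (-Real.pi)..Real.pi, g φ = 2 * (Real.pi * prodTail t ρ) := by
    rw [← intervalIntegral.integral_add_adjacent_intervals (hint _ 0) (hint 0 _), heven, h0]
    ring
  have h2 : ∀ a : ℝ, ∫ φ in a..(a + 2 * Real.pi), g φ = 2 * (Real.pi * prodTail t ρ) := by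
    intro a
    rw [hper.intervalIntegral_add_eq a (-Real.pi), ← h1]
    congr 1
    ring
  have h3 := intervalIntegral.integral_comp_mul_left (a := -Real.pi) (b := Real.pi) g two_ne_zero
  rw [h3, ← intervalIntegral.integral_add_adjacent_intervals (hint _ 0) (hint 0 _)]
  have e1 := h2 (2 * -Real.pi)
  have e2 := h2 0
  rw [show 2 * -Real.pi + 2 * Real.pi = 0 by ring] at e1
  rw [zero_add] at e2
  rw [e1, e2, smul_eq_mul]
  ring

theorem lintegral_Ioi_mul_exp_neg_sq {R : ℝ} (hR : 0 ≤ R) :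
    ∫⁻ r in Set.Ioi R, ENNReal.ofReal (r * Real.exp (-(r ^ 2 / 2))) =
      ENNReal.ofReal (Real.exp (-(R ^ 2 / 2))) := by
  have hd : ∀ r ∈ Set.Ici R, HasDerivAt (fun x : ℝ => -Real.exp (-(x ^ 2 / 2)))
      (r * Real.exp (-(r ^ 2 / 2))) r := by
    intro r _
    have h1 : HasDerivAt (fun x : ℝ => -(x ^ 2 / 2)) (-r) r := by
      refine (((hasDerivAt_pow 2 r).div_const 2).neg).congr_deriv ?_
      simp
    refine h1.exp.neg.congr_deriv ?_
    ring
  have hpos : ∀ r ∈ Set.Ioi R, 0 ≤ r * Real.exp (-(r ^ 2 / 2)) := fun r hr =>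
    mul_nonneg (hR.trans (le_of_lt hr)) (Real.exp_pos _).le
  have hlim : Filter.Tendsto (fun x : ℝ => -Real.exp (-(x ^ 2 / 2))) Filter.atTop (nhds 0) := by
    rw [← neg_zero]
    refine (Real.tendsto_exp_neg_atTop_nhds_zero.comp ?_).neg
    exact (Filter.tendsto_pow_atTop two_ne_zero).atTop_div_const two_pos
  rw [← ofReal_integral_eq_lintegral_ofReal (integrableOn_Ioi_deriv_of_nonneg' hd hpos hlim)
    ((ae_restrict_iff' measurableSet_Ioi).2 (Filter.Eventually.of_forall hpos)),
    integral_Ioi_of_hasDerivAt_of_nonneg' hd hpos hlim]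
  simp

/-- The radial integral of the Gaussian density over the set where a quadratic form, equal to
`κ / 2` in the given direction, exceeds `t`. -/
theorem lintegral_radial {t : ℝ} (ht : 0 < t) (κ : ℝ) :
    ∫⁻ r in Set.Ioi (0 : ℝ), {r : ℝ | t < r ^ 2 * κ / 2}.indicator
      (fun r => ENNReal.ofReal (r * Real.exp (-(r ^ 2 / 2)))) r =
        ENNReal.ofReal (expNegDiv t κ) := by
  have hm : MeasurableSet {r : ℝ | t < r ^ 2 * κ / 2} :=
    measurableSet_lt measurable_const (by fun_prop)
  rw [setLIntegral_indicator hm]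
  by_cases hκ : 0 < κ
  · have hset : {r : ℝ | t < r ^ 2 * κ / 2} ∩ Set.Ioi 0 = Set.Ioi (Real.sqrt (2 * t / κ)) := by
      ext r
      simp only [Set.mem_inter_iff, Set.mem_ofPred_eq, Set.mem_Ioi]
      constructor
      · rintro ⟨h1, h2⟩
        rw [Real.sqrt_lt' h2, div_lt_iff₀ hκ]
        linarith
      · intro h
        have h2 : 0 < r := (Real.sqrt_nonneg _).trans_lt h
        rw [Real.sqrt_lt' h2, div_lt_iff₀ hκ] at h
        exact ⟨by linarith, h2⟩
    rw [hset, lintegral_Ioi_mul_exp_neg_sq (Real.sqrt_nonneg _), Real.sq_sqrt (by positivity),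
      expNegDiv, if_pos hκ]
    congr 3
    field_simp
  · have hset : {r : ℝ | t < r ^ 2 * κ / 2} ∩ Set.Ioi 0 = ∅ := by
      ext r
      simp only [Set.mem_inter_iff, Set.mem_ofPred_eq, Set.mem_Ioi, Set.mem_empty_iff_false,
        iff_false, not_and]
      intro h1
      exfalso
      have := mul_nonneg (sq_nonneg r) (neg_nonneg.2 (not_lt.1 hκ))
      nlinarith
    simp [hset, expNegDiv, hκ]

theorem gaussianPDF_mul_gaussianPDF (x y : ℝ) :
    gaussianPDF 0 1 x * gaussianPDF 0 1 y =
      ENNReal.ofReal ((2 * Real.pi)⁻¹) * ENNReal.ofReal (Real.exp (-((x ^ 2 + y ^ 2) / 2))) := by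
  have hpi := Real.pi_pos
  rw [gaussianPDF, gaussianPDF, ← ENNReal.ofReal_mul (gaussianPDFReal_nonneg _ _ _),
    ← ENNReal.ofReal_mul (by positivity)]
  congr 1
  simp only [gaussianPDFReal, NNReal.coe_one, mul_one, sub_zero]
  rw [mul_mul_mul_comm, ← Real.exp_add, ← mul_inv, Real.mul_self_sqrt (by positivity)]
  congr 2
  ring

/-- In polar coordinates the form is `r² (cos 2θ + ρ) / 2`. The radial integral is explicit and
leaves `exp (-t / (cos 2θ + ρ))` where the denominator is positive, to be averaged over `θ`. -/
theorem gaussianReal_prod_quadratic {t : ℝ} (ht : 0 < t) {α β ρ : ℝ} (h1 : α ^ 2 + β ^ 2 = 1)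
    (h2 : α ^ 2 - β ^ 2 = ρ) :
    ((gaussianReal 0 1).prod (gaussianReal 0 1)) {p | t < (α * p.1) ^ 2 - (β * p.2) ^ 2} =
      ENNReal.ofReal (prodTail t ρ) := by
  have hpi := Real.pi_pos
  have hm : MeasurableSet {p : ℝ × ℝ | t < (α * p.1) ^ 2 - (β * p.2) ^ 2} :=
    measurableSet_lt measurable_const (by fun_prop)
  rw [gaussianReal_of_var_ne_zero _ one_ne_zero, prod_withDensity (by fun_prop) (by fun_prop),
    withDensity_apply _ hm, ← lintegral_indicator hm, ← Measure.volume_eq_prod,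
    ← lintegral_comp_polarCoord_symm, polarCoord_target, Measure.volume_eq_prod,
    ← Measure.prod_restrict]
  have key : ∀ p ∈ Set.Ioi (0 : ℝ) ×ˢ Set.Ioo (-Real.pi) Real.pi,
      ENNReal.ofReal p.1 • {p : ℝ × ℝ | t < (α * p.1) ^ 2 - (β * p.2) ^ 2}.indicator
        (fun a => gaussianPDF 0 1 a.1 * gaussianPDF 0 1 a.2) (polarCoord.symm p) =
      ENNReal.ofReal ((2 * Real.pi)⁻¹) *
        {r : ℝ | t < r ^ 2 * (Real.cos (2 * p.2) + ρ) / 2}.indicator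
          (fun r => ENNReal.ofReal (r * Real.exp (-(r ^ 2 / 2)))) p.1 := by
    rintro ⟨r, θ⟩ ⟨hr, -⟩
    have hr : (0 : ℝ) < r := hr
    have hq : (α * (r * Real.cos θ)) ^ 2 - (β * (r * Real.sin θ)) ^ 2 =
        r ^ 2 * (Real.cos (2 * θ) + ρ) / 2 := by
      rw [Real.cos_two_mul, ← h2]
      have := Real.sin_sq_add_cos_sq θ
      linear_combination (-r ^ 2 * β ^ 2) * this + r ^ 2 * (Real.cos θ ^ 2 - 1 / 2) * h1
    have hexp : (r * Real.cos θ) ^ 2 + (r * Real.sin θ) ^ 2 = r ^ 2 := by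
      have := Real.sin_sq_add_cos_sq θ
      linear_combination r ^ 2 * this
    simp only [polarCoord_symm_apply, Set.indicator_apply, Set.mem_ofPred_eq, hq, smul_eq_mul]
    split_ifs
    · rw [gaussianPDF_mul_gaussianPDF, hexp, ENNReal.ofReal_mul hr.le]
      ring
    · simp
  rw [Measure.prod_restrict, ← Measure.volume_eq_prod,
    setLIntegral_congr_fun (measurableSet_Ioi.prod measurableSet_Ioo) key,
    Measure.volume_eq_prod, ← Measure.prod_restrict, lintegral_prod_symm]
  · have inner : ∀ θ : ℝ, ∫⁻ r in Set.Ioi (0 : ℝ), ENNReal.ofReal ((2 * Real.pi)⁻¹) *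
        {r : ℝ | t < r ^ 2 * (Real.cos (2 * θ) + ρ) / 2}.indicator
          (fun r => ENNReal.ofReal (r * Real.exp (-(r ^ 2 / 2)))) r =
        ENNReal.ofReal ((2 * Real.pi)⁻¹) *
          ENNReal.ofReal (expNegDiv t (Real.cos (2 * θ) + ρ)) := by
      intro θ
      rw [lintegral_const_mul' _ _ ENNReal.ofReal_ne_top, lintegral_radial ht]
    simp only [inner]
    rw [lintegral_const_mul' _ _ ENNReal.ofReal_ne_top, ← ofReal_integral_eq_lintegral_ofReal,
      ← integral_Ioc_eq_integral_Ioo, ← intervalIntegral.integral_of_le (by linarith),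
      integral_expNegDiv_cos_two_mul ht.le, ← ENNReal.ofReal_mul (by positivity)]
    · congr 1
      field_simp
    · refine Measure.integrableOn_of_bounded (M := 1) (by simp) ?_ ?_
      · exact ((measurable_expNegDiv t).comp (by fun_prop)).aestronglyMeasurable
      · refine Filter.Eventually.of_forall fun φ => ?_
        rw [Real.norm_of_nonneg (expNegDiv_nonneg _ _)]
        exact expNegDiv_le_one ht.le _
    · exact Filter.Eventually.of_forall fun φ => expNegDiv_nonneg _ _
  · refine Measurable.aemeasurable (Measurable.const_mul ?_ _)
    have : Measurable fun p : ℝ × ℝ =>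
        {p : ℝ × ℝ | t < p.1 ^ 2 * (Real.cos (2 * p.2) + ρ) / 2}.indicator
        (fun p => ENNReal.ofReal (p.1 * Real.exp (-(p.1 ^ 2 / 2)))) p :=
      Measurable.indicator (by fun_prop) (measurableSet_lt measurable_const (by fun_prop))
    exact this

section StdGaussianProducts

variable {n : ℕ}

theorem stdGaussian_map_inner (x : EuclideanSpace ℝ (Fin n)) :
    (stdGaussian (EuclideanSpace ℝ (Fin n))).map (fun a => inner ℝ x a) =
      (gaussianReal 0 1).map (‖x‖ * ·) := by
  have h := IsGaussian.map_eq_gaussianReal (μ := stdGaussian (EuclideanSpace ℝ (Fin n)))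
    (innerSL ℝ x)
  rw [integral_strongDual_stdGaussian, variance_dual_stdGaussian, innerSL_apply_norm] at h
  rw [gaussianReal_map_const_mul]
  refine Eq.trans h ?_
  rw [mul_zero, mul_one]
  congr 1
  ext
  simp

theorem stdGaussian_map_inner_prod {x y : EuclideanSpace ℝ (Fin n)} (hxy : inner ℝ x y = 0) :
    (stdGaussian (EuclideanSpace ℝ (Fin n))).map (fun a => (inner ℝ x a, inner ℝ y a)) =
      ((gaussianReal 0 1).prod (gaussianReal 0 1)).map (fun p => (‖x‖ * p.1, ‖y‖ * p.2)) := by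
  -- The two forms are jointly Gaussian with covariance `⟨x, y⟩ = 0`, hence independent.
  have hG : HasGaussianLaw (fun a : EuclideanSpace ℝ (Fin n) => (inner ℝ x a, inner ℝ y a))
      (stdGaussian (EuclideanSpace ℝ (Fin n))) :=
    (IsGaussian.hasGaussianLaw_id
      (μ := stdGaussian (EuclideanSpace ℝ (Fin n)))).map_fun ((innerSL ℝ x).prod (innerSL ℝ y))
  have hc : cov[fun a => inner ℝ x a, fun a => inner ℝ y a;
      stdGaussian (EuclideanSpace ℝ (Fin n))] = 0 := by
    rw [← covarianceBilin_apply_eq_cov IsGaussian.memLp_two_id, covarianceBilin_stdGaussian]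
    exact hxy
  have hI := hG.indepFun_of_covariance_eq_zero hc
  rw [indepFun_iff_map_prod_eq_prod_map_map (by fun_prop) (by fun_prop)] at hI
  rw [hI, stdGaussian_map_inner, stdGaussian_map_inner, Measure.map_prod_map _ _ (by fun_prop)
    (by fun_prop)]
  rfl

/-- The upper tail of the product of two linear forms of a standard Gaussian vector. -/
theorem stdGaussian_inner_mul_inner {u v : EuclideanSpace ℝ (Fin n)} (hu : ‖u‖ = 1) (hv : ‖v‖ = 1)
    {t : ℝ} (ht : 0 < t) :
    (stdGaussian (EuclideanSpace ℝ (Fin n))).real {a | t < inner ℝ a u * inner ℝ a v} =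
      prodTail t (inner ℝ u v) := by
  -- Polarisation: `⟨a, u⟩⟨a, v⟩ = ⟨a, x⟩² - ⟨a, y⟩²`, and `x ⊥ y` because `‖u‖ = ‖v‖`.
  set x : EuclideanSpace ℝ (Fin n) := (1 / 2 : ℝ) • (u + v) with hx
  set y : EuclideanSpace ℝ (Fin n) := (1 / 2 : ℝ) • (u - v) with hy
  have huu : inner ℝ u u = (1 : ℝ) := by rw [real_inner_self_eq_norm_sq, hu, one_pow]
  have hvv : inner ℝ v v = (1 : ℝ) := by rw [real_inner_self_eq_norm_sq, hv, one_pow]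
  have hvu : inner ℝ v u = inner ℝ u v := real_inner_comm _ _
  have hxy : inner ℝ x y = 0 := by
    simp only [hx, hy, inner_smul_left, inner_smul_right, inner_add_left, inner_sub_right, huu, hvv,
      hvu]
    simp
    ring
  have hxx : ‖x‖ ^ 2 = (1 + inner ℝ u v) / 2 := by
    rw [← real_inner_self_eq_norm_sq]
    simp only [hx, inner_smul_left, inner_smul_right, inner_add_left, inner_add_right, huu, hvv,
      hvu]
    simp
    ring
  have hyy : ‖y‖ ^ 2 = (1 - inner ℝ u v) / 2 := by
    rw [← real_inner_self_eq_norm_sq]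
    simp only [hy, inner_smul_left, inner_smul_right, inner_sub_left, inner_sub_right, huu, hvv,
      hvu]
    simp
    ring
  have hS : MeasurableSet {p : ℝ × ℝ | t < p.1 ^ 2 - p.2 ^ 2} :=
    measurableSet_lt measurable_const (by fun_prop)
  have hset : {a : EuclideanSpace ℝ (Fin n) | t < inner ℝ a u * inner ℝ a v} =
      (fun a => (inner ℝ x a, inner ℝ y a)) ⁻¹' {p : ℝ × ℝ | t < p.1 ^ 2 - p.2 ^ 2} := by
    ext a
    have : (inner ℝ x a : ℝ) ^ 2 - (inner ℝ y a) ^ 2 = inner ℝ a u * inner ℝ a v := by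
      rw [real_inner_comm a x, real_inner_comm a y]
      simp only [hx, hy, inner_smul_right, inner_add_right, inner_sub_right]
      ring
    simp [this]
  have hpos : 0 ≤ prodTail t (inner ℝ u v) :=
    div_nonneg (intervalIntegral.integral_nonneg Real.pi_pos.le fun _ _ => expNegDiv_nonneg _ _)
      Real.pi_pos.le
  rw [measureReal_def, hset, ← Measure.map_apply (by fun_prop) hS, stdGaussian_map_inner_prod hxy,
    Measure.map_apply (by fun_prop) hS]
  have := gaussianReal_prod_quadratic ht (α := ‖x‖) (β := ‖y‖) (ρ := inner ℝ u v)
    (by rw [hxx, hyy]; ring) (by rw [hxx, hyy]; ring)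
  rw [show (fun p : ℝ × ℝ => (‖x‖ * p.1, ‖y‖ * p.2)) ⁻¹' {p : ℝ × ℝ | t < p.1 ^ 2 - p.2 ^ 2} =
    {p | t < (‖x‖ * p.1) ^ 2 - (‖y‖ * p.2) ^ 2} from rfl, this, ENNReal.toReal_ofReal hpos]

theorem stdGaussian_abs_inner_mul_inner {u v : EuclideanSpace ℝ (Fin n)} (hu : ‖u‖ = 1)
    (hv : ‖v‖ = 1) {t : ℝ} (ht : 0 < t) :
    (stdGaussian (EuclideanSpace ℝ (Fin n))).real {a | t < |inner ℝ a u * inner ℝ a v|} =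
      prodTail t (inner ℝ u v) + prodTail t (-inner ℝ u v) := by
  have h1 := stdGaussian_inner_mul_inner hu hv ht
  -- The lower tail is the upper tail for `-u`, whose correlation with `v` is `-ρ`.
  have h2 := stdGaussian_inner_mul_inner (u := -u) (by rwa [norm_neg]) hv ht
  rw [inner_neg_left] at h2
  rw [← h1, ← h2, ← measureReal_union]
  · congr 1
    ext a
    simp [-abs_mul, lt_abs, inner_neg_right]
  · rw [Set.disjoint_left]
    intro a ha hb
    simp only [Set.mem_ofPred_eq, inner_neg_right] at ha hb
    linarith
  · exact measurableSet_lt measurable_const (by fun_prop)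

end StdGaussianProducts

/-! ### The nearly collinear case -/

theorem intervalIntegral_exp_neg_sq_ge :
    0.63998 ≤ ∫ x in (0 : ℝ)..0.69137, Real.exp (-(x ^ 2 / 2)) := by
  have hb : ∀ x ∈ Set.Icc (0 : ℝ) 0.69137,
      1 - x ^ 2 / 2 + x ^ 4 / 8 - x ^ 6 / 48 + x ^ 8 / 384 - x ^ 10 / 3200 ≤
        Real.exp (-(x ^ 2 / 2)) := by
    intro x hx
    have h1 : x ^ 2 ≤ 1 := by nlinarith [hx.1, hx.2]
    -- The remainder after five terms is at most `|y|⁵ / 100` with `y = x² / 2`, which is the term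
    -- `x ^ 10 / 3200`.
    have h := (abs_le.1 (Real.exp_bound (x := -(x ^ 2 / 2)) (by
      rw [abs_neg, abs_of_nonneg (by positivity)]; linarith) (n := 5) (by norm_num))).1
    rw [abs_neg, abs_of_nonneg (by positivity)] at h
    simp only [Finset.sum_range_succ, Finset.sum_range_zero, Nat.factorial] at h
    norm_num at h
    have h10 : 0 ≤ x ^ 10 := by positivity
    ring_nf at h ⊢
    linarith
  refine le_trans ?_ (intervalIntegral.integral_mono_on (by norm_num) ?_ ?_ hb)
  · have hd : ∀ x ∈ Set.uIcc (0 : ℝ) 0.69137, HasDerivAt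
        (fun x : ℝ => x - x ^ 3 / 6 + x ^ 5 / 40 - x ^ 7 / 336 + x ^ 9 / 3456 - x ^ 11 / 35200)
        (1 - x ^ 2 / 2 + x ^ 4 / 8 - x ^ 6 / 48 + x ^ 8 / 384 - x ^ 10 / 3200) x := by
      intro x _
      refine ((((((hasDerivAt_id x).sub ((hasDerivAt_pow 3 x).div_const 6)).add
        ((hasDerivAt_pow 5 x).div_const 40)).sub ((hasDerivAt_pow 7 x).div_const 336)).add
        ((hasDerivAt_pow 9 x).div_const 3456)).sub
        ((hasDerivAt_pow 11 x).div_const 35200)).congr_deriv ?_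
      norm_num
      ring
    rw [intervalIntegral.integral_eq_sub_of_hasDerivAt hd
      (Continuous.intervalIntegrable (by fun_prop) _ _)]
    norm_num
  · exact Continuous.intervalIntegrable (by fun_prop) _ _
  · exact Continuous.intervalIntegrable (by fun_prop) _ _

theorem gaussianReal_Icc_ge : 0.5106 ≤ (gaussianReal 0 1).real (Set.Icc (-0.69137) 0.69137) := by
  have hpi := Real.pi_pos
  have h0 : (gaussianReal 0 1).real (Set.Icc (-0.69137) 0.69137) =
      (√(2 * Real.pi))⁻¹ * (2 * ∫ x in (0 : ℝ)..0.69137, Real.exp (-(x ^ 2 / 2))) := by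
    rw [measureReal_def, gaussianReal_apply_eq_integral _ one_ne_zero, ENNReal.toReal_ofReal
      (integral_nonneg fun x => gaussianPDFReal_nonneg _ _ _), integral_Icc_eq_integral_Ioc,
      ← intervalIntegral.integral_of_le (by norm_num)]
    simp only [gaussianPDFReal, NNReal.coe_one, mul_one, sub_zero]
    rw [intervalIntegral.integral_const_mul]
    congr 1
    have hi : ∀ a b : ℝ, IntervalIntegrable (fun x : ℝ => Real.exp (-(x ^ 2 / 2))) volume a b :=
      fun a b => Continuous.intervalIntegrable (by fun_prop) _ _
    simp only [neg_div]
    rw [← intervalIntegral.integral_add_adjacent_intervals (hi _ 0) (hi 0 _)]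
    have := intervalIntegral.integral_comp_neg (f := fun x : ℝ => Real.exp (-(x ^ 2 / 2)))
      (a := 0) (b := 0.69137)
    simp only [even_two.neg_pow, neg_zero] at this
    rw [← this]
    ring
  have hs : √(2 * Real.pi) ≤ 2.50664 := by
    rw [Real.sqrt_le_left (by norm_num)]
    have := Real.pi_lt_d4
    norm_num at this ⊢
    linarith
  have hs0 : 0 < √(2 * Real.pi) := by positivity
  rw [h0, ← div_eq_inv_mul, le_div_iff₀ hs0]
  have := intervalIntegral_exp_neg_sq_ge
  norm_num at this hs ⊢
  linarith

/-- With `u = v` in dimension one the product is a squared standard Gaussian, so this is the normal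
tail beyond `√0.478 > 0.69137`. -/
theorem prodTail_one_le : prodTail 0.478 1 ≤ 0.4894 := by
  let e : EuclideanSpace ℝ (Fin 1) := EuclideanSpace.single 0 1
  have he : ‖e‖ = 1 := by simp [e]
  have h := stdGaussian_inner_mul_inner he he (t := 0.478) (by norm_num)
  rw [real_inner_self_eq_norm_sq, he, one_pow] at h
  have hmap := stdGaussian_map_inner e
  simp only [he, one_mul, Measure.map_id'] at hmap
  have hm : MeasurableSet {x : ℝ | 0.478 < x * x} := measurableSet_lt measurable_const (by fun_prop)
  have hset : {a : EuclideanSpace ℝ (Fin 1) | (0.478 : ℝ) < inner ℝ a e * inner ℝ a e} =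
      (fun a => inner ℝ e a) ⁻¹' {x : ℝ | 0.478 < x * x} := by
    ext a
    simp [real_inner_comm a]
  rw [measureReal_def, hset, ← Measure.map_apply (by fun_prop) hm, hmap, ← measureReal_def] at h
  rw [← h]
  have hsub : {x : ℝ | 0.478 < x * x} ⊆ (Set.Icc (-0.69137) 0.69137)ᶜ := by
    intro x hx hx'
    simp only [Set.mem_ofPred_eq] at hx
    have h1 := hx'.1
    have h2 := hx'.2
    norm_num at hx h1 h2
    nlinarith
  refine (measureReal_mono hsub).trans ?_
  rw [probReal_compl_eq_one_sub measurableSet_Icc]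
  have := gaussianReal_Icc_ge
  norm_num at this ⊢
  linarith

theorem prodTail_neg_le : prodTail 0.478 (-0.94) ≤ 0.0004 := by
  have h := prodTail_le_tailUp (N := 64) (by norm_num) 478000 (-940000)
  have h2 : tailUp 64 478000 (-940000) ≤ 25600 := by decide +kernel
  have h3 : (tailUp 64 478000 (-940000) : ℝ) ≤ 25600 := by exact_mod_cast h2
  norm_num at h ⊢
  linarith

theorem prodTail_add_prodTail_neg_le {ρ : ℝ} (h0 : 0 ≤ ρ) (h1 : ρ ≤ 1) :
    prodTail 0.478 ρ + prodTail 0.478 (-ρ) ≤ 0.4898 := by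
  rcases le_total ρ 0.94 with h | h
  · exact prodTail_add_prodTail_neg_le_of_le h0 h
  · have e1 := (prodTail_mono (t := 0.478) (by norm_num) h1).trans prodTail_one_le
    have e2 := (prodTail_mono (t := 0.478) (by norm_num) (neg_le_neg h)).trans prodTail_neg_le
    norm_num at e1 e2 ⊢
    linarith

theorem stdGaussian_abs_inner_mul_inner_gt_le {n : ℕ} {u v : EuclideanSpace ℝ (Fin n)}
    (hu : ‖u‖ = 1) (hv : ‖v‖ = 1) :
    (stdGaussian (EuclideanSpace ℝ (Fin n))).real {a | 0.478 < |inner ℝ a u * inner ℝ a v|} ≤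
      0.4898 := by
  rw [stdGaussian_abs_inner_mul_inner hu hv (by norm_num)]
  have h1 : |(inner ℝ u v : ℝ)| ≤ 1 := by
    simpa [hu, hv] using abs_real_inner_le_norm u v
  have h := prodTail_add_prodTail_neg_le (abs_nonneg _) h1
  rcases abs_choice (inner ℝ u v : ℝ) with e | e <;> rw [e] at h
  · exact h
  · rwa [neg_neg, add_comm] at h

theorem stdGaussian_abs_inner_mul_inner_le_le {n : ℕ} {u v : EuclideanSpace ℝ (Fin n)}
    (hu : ‖u‖ = 1) (hv : ‖v‖ = 1) :
    (stdGaussian (EuclideanSpace ℝ (Fin n))).real {a | |inner ℝ a u * inner ℝ a v| ≤ 0.315} ≤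
      0.4898 := by
  have h1 : |(inner ℝ u v : ℝ)| ≤ 1 := by
    simpa [hu, hv] using abs_real_inner_le_norm u v
  have h := le_prodTail_add_prodTail_neg (abs_nonneg _) h1
  have h2 : prodTail 0.315 |(inner ℝ u v : ℝ)| + prodTail 0.315 (-|(inner ℝ u v : ℝ)|) =
      prodTail 0.315 (inner ℝ u v) + prodTail 0.315 (-inner ℝ u v) := by
    rcases abs_choice (inner ℝ u v : ℝ) with e | e <;> rw [e]
    rw [neg_neg, add_comm]
  rw [h2, ← stdGaussian_abs_inner_mul_inner hu hv (by norm_num)] at h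
  have hm : MeasurableSet {a : EuclideanSpace ℝ (Fin n) | 0.315 < |inner ℝ a u * inner ℝ a v|} :=
    measurableSet_lt measurable_const (by fun_prop)
  have hc : {a : EuclideanSpace ℝ (Fin n) | |inner ℝ a u * inner ℝ a v| ≤ (0.315 : ℝ)} =
      {a | 0.315 < |inner ℝ a u * inner ℝ a v|}ᶜ := by
    ext a
    simp
  rw [hc, probReal_compl_eq_one_sub hm]
  norm_num at h ⊢
  linarith

/-! ### The rows of a Gaussian matrix -/

section Rows

variable {Ω : Type*} [MeasurableSpace Ω] {P : Measure Ω} {m n : ℕ}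
  {a : Fin m → Ω → EuclideanSpace ℝ (Fin n)}

theorem IsIIDStdGaussianEntries.hasGaussianLaw_entry (h : IsIIDStdGaussianEntries P a)
    (k : Fin m × Fin n) : HasGaussianLaw (fun ω => a k.1 ω k.2) P where
  isGaussian_map := by
    rw [(h.hasLaw k.1 k.2).map_eq]
    infer_instance

theorem IsIIDStdGaussianEntries.iIndepFun_rows [IsProbabilityMeasure P]
    (h : IsIIDStdGaussianEntries P a) : iIndepFun a P := by
  have hG := h.indep.hasGaussianLaw h.hasGaussianLaw_entry
  have hG2 : HasGaussianLaw (fun ω (i : Fin m) (j : Fin n) => a i ω j) P :=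
    hG.map_fun (ContinuousLinearMap.pi fun i => ContinuousLinearMap.pi fun j =>
      ContinuousLinearMap.proj (R := ℝ) (φ := fun _ : Fin m × Fin n => ℝ) (i, j))
  have hI : iIndepFun (fun i ω (j : Fin n) => a i ω j) P := by
    refine HasGaussianLaw.iIndepFun_of_covariance_eval (X := fun i j ω => a i ω j) hG2 ?_
    -- Independent Gaussian entries are jointly Gaussian, so independence of the rows only needs
    -- vanishing covariances between entries of different rows.
    intro i i' hii k l
    have hne : (i, k) ≠ (i', l) := fun e => hii (Prod.ext_iff.1 e).1
    exact (h.indep.indepFun hne).covariance_eq_zero (h.hasGaussianLaw_entry (i, k)).memLp_two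
      (h.hasGaussianLaw_entry (i', l)).memLp_two
  exact hI.comp (fun _ => WithLp.toLp 2) fun _ => by fun_prop

theorem IsIIDStdGaussianEntries.hasLaw_row [IsProbabilityMeasure P]
    (h : IsIIDStdGaussianEntries P a) (i : Fin m) :
    HasLaw (a i) (stdGaussian (EuclideanSpace ℝ (Fin n))) P := by
  have hm : ∀ j, AEMeasurable (fun ω => a i ω j) P := fun j => (h.hasLaw i j).aemeasurable
  have hmp : AEMeasurable (fun ω j => a i ω j) P := aemeasurable_pi_lambda _ hm
  have hI : iIndepFun (fun j ω => a i ω j) P :=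
    h.indep.precomp (g := fun j : Fin n => (i, j)) fun j j' e => (Prod.ext_iff.1 e).2
  have hmap := (iIndepFun_iff_map_fun_eq_pi_map hm).1 hI
  simp only [(h.hasLaw i _).map_eq] at hmap
  have e : a i = WithLp.toLp 2 ∘ fun ω j => a i ω j := rfl
  constructor
  · rw [e]
    exact (show Measurable (WithLp.toLp 2 : (Fin n → ℝ) → EuclideanSpace ℝ (Fin n)) by
      fun_prop).comp_aemeasurable hmp
  · rw [← map_pi_eq_stdGaussian, ← hmap, AEMeasurable.map_map_of_aemeasurable _ hmp]
    · rfl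
    · exact Measurable.aemeasurable (by fun_prop)

end Rows

/-! ### Concentration of empirical frequencies -/

open scoped Classical in
/-- Hoeffding's inequality for the number of samples that fall into a given set. -/
theorem measureReal_card_ge_le {Ω E : Type*} [MeasurableSpace Ω] [MeasurableSpace E]
    {P : Measure Ω} [IsProbabilityMeasure P] {m : ℕ} {X : Fin m → Ω → E} {μ : Measure E}
    (hI : iIndepFun X P) (hX : ∀ i, HasLaw (X i) μ P) {S : Set E} (hS : MeasurableSet S) {q ε : ℝ}
    (hq : μ.real S ≤ q) (hε : 0 ≤ ε) :
    P.real {ω | (q + ε) * m ≤ (Finset.univ.filter fun i => X i ω ∈ S).card} ≤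
      Real.exp (-(2 * ε ^ 2 * m)) := by
  have hf : Measurable (S.indicator fun _ : E => (1 : ℝ)) := measurable_const.indicator hS
  let Y : Fin m → Ω → ℝ := fun i ω => S.indicator (fun _ => (1 : ℝ)) (X i ω)
  have hYm : ∀ i, AEMeasurable (Y i) P := fun i => hf.comp_aemeasurable (hX i).aemeasurable
  have hE : ∀ i, P[Y i] = μ.real S := by
    intro i
    rw [show Y i = S.indicator (fun _ => (1 : ℝ)) ∘ X i from rfl,
      (hX i).integral_comp hf.aestronglyMeasurable]
    simp [integral_indicator hS]
  -- A variable in `[0, 1]` has variance proxy `1/4`, whence the exponent `(ε m)² / (2 · m / 4) = 2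
  -- ε² m`.
  have hsub : ∀ i, HasSubgaussianMGF (fun ω => Y i ω - μ.real S) ((‖(1 : ℝ) - 0‖₊ / 2) ^ 2) P := by
    intro i
    have := hasSubgaussianMGF_of_mem_Icc (a := 0) (b := 1) (hYm i)
      (Filter.Eventually.of_forall fun ω => by
        by_cases h : X i ω ∈ S <;> simp [Y, h])
    rwa [hE i] at this
  have hI' : iIndepFun (fun i ω => Y i ω - μ.real S) P :=
    hI.comp (fun _ x => S.indicator (fun _ => (1 : ℝ)) x - μ.real S) fun _ => hf.sub_const _
  have h := HasSubgaussianMGF.measure_sum_ge_le_of_iIndepFun hI' (s := Finset.univ)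
    (fun i _ => hsub i) (ε := ε * m) (by positivity)
  refine (measureReal_mono ?_).trans (h.trans (le_of_eq ?_))
  · intro ω hω
    simp only [Set.mem_ofPred_eq] at hω ⊢
    have hsum : ∑ i, Y i ω = ((Finset.univ.filter fun i => X i ω ∈ S).card : ℝ) := by
      simp [Y, Set.indicator_apply]
    rw [Finset.sum_sub_distrib, hsum]
    simp only [Finset.sum_const, Finset.card_univ, Fintype.card_fin, nsmul_eq_mul]
    have := mul_le_mul_of_nonneg_left hq (Nat.cast_nonneg (α := ℝ) m)
    linarith
  · congr 1
    rcases Nat.eq_zero_or_pos m with rfl | hm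
    · simp
    · have : (0 : ℝ) < m := by exact_mod_cast hm
      simp
      field_simp

theorem integral_norm_sq_stdGaussian (n : ℕ) :
    ∫ a, ‖a‖ ^ 2 ∂(stdGaussian (EuclideanSpace ℝ (Fin n))) = n := by
  have hvar : ∀ j : Fin n, ∫ a, (a j) ^ 2 ∂(stdGaussian (EuclideanSpace ℝ (Fin n))) = 1 := by
    intro j
    have hL : ∀ a : EuclideanSpace ℝ (Fin n),
        innerSL ℝ (EuclideanSpace.single j (1 : ℝ)) a = a j := by
      intro a
      simp [innerSL_apply_apply, EuclideanSpace.inner_single_left]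
    have h := variance_dual_stdGaussian (innerSL ℝ (EuclideanSpace.single j (1 : ℝ)))
    rw [innerSL_apply_norm, variance_of_integral_eq_zero
      (ContinuousLinearMap.continuous _).aemeasurable (integral_strongDual_stdGaussian _)] at h
    simp only [hL] at h
    simpa using h
  have hint : ∀ j : Fin n, Integrable (fun a => (a j) ^ 2)
      (stdGaussian (EuclideanSpace ℝ (Fin n))) := fun j =>
    -- A non-integrable function has integral `0` by convention, so a nonzero integral proves
    -- integrability.
    Integrable.of_integral_ne_zero (by rw [hvar j]; exact one_ne_zero)
  simp only [EuclideanSpace.real_norm_sq_eq]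
  rw [integral_finsetSum _ fun j _ => hint j]
  simp [hvar]

theorem stdGaussian_norm_sq_gt_le {n : ℕ} (hn : 0 < n) {K : ℝ} (hK : 0 < K) :
    (stdGaussian (EuclideanSpace ℝ (Fin n))).real {a | K * n < ‖a‖ ^ 2} ≤ 1 / K := by
  have hn' : (0 : ℝ) < n := by exact_mod_cast hn
  have hI := integral_norm_sq_stdGaussian n
  have h := mul_meas_ge_le_integral_of_nonneg (μ := stdGaussian (EuclideanSpace ℝ (Fin n)))
    (f := fun a => ‖a‖ ^ 2) (Filter.Eventually.of_forall fun a => by positivity)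
    (Integrable.of_integral_ne_zero (by rw [hI]; exact hn'.ne')) (K * n)
  rw [hI] at h
  have hmono : (stdGaussian (EuclideanSpace ℝ (Fin n))).real {a | K * n < ‖a‖ ^ 2} ≤
      (stdGaussian (EuclideanSpace ℝ (Fin n))).real {a | K * n ≤ ‖a‖ ^ 2} :=
    measureReal_mono fun a (ha : K * n < ‖a‖ ^ 2) => ha.le
  rw [le_div_iff₀ hK]
  have h2 : K * n * (stdGaussian (EuclideanSpace ℝ (Fin n))).real {a | K * n < ‖a‖ ^ 2} ≤ n :=
    (mul_le_mul_of_nonneg_left hmono (by positivity)).trans h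
  nlinarith

/-! ### A net of the unit sphere -/

/-- Cut space into cubes of side `1 / M` and keep one unit vector from each cube that meets the
sphere. Net points must themselves be unit vectors, because the tail estimates are for unit vectors.
-/
theorem exists_sphere_net (n M : ℕ) (hM : 0 < M) :
    ∃ T : Finset (EuclideanSpace ℝ (Fin n)), (∀ u ∈ T, ‖u‖ = 1) ∧ T.card ≤ (2 * M + 1) ^ n ∧
      ∀ u : EuclideanSpace ℝ (Fin n), ‖u‖ = 1 → ∃ u₀ ∈ T, ‖u - u₀‖ ≤ n / M := by
  classical
  have hM' : (0 : ℝ) < M := by exact_mod_cast hM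
  let cell : EuclideanSpace ℝ (Fin n) → Fin n → ℤ := fun u j => ⌊u j * M⌋
  let keys : Finset (Fin n → ℤ) := Fintype.piFinset fun _ => Finset.Icc (-(M : ℤ)) M
  have hkey : ∀ u : EuclideanSpace ℝ (Fin n), ‖u‖ = 1 → cell u ∈ keys := by
    intro u hu
    refine Fintype.mem_piFinset.2 fun j => Finset.mem_Icc.2 ?_
    have h1 : |u j| ≤ 1 := by
      rw [← hu, ← Real.norm_eq_abs]
      exact PiLp.norm_apply_le u j
    obtain ⟨h2, h3⟩ := abs_le.1 h1
    constructor
    · refine Int.le_floor.2 ?_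
      push_cast
      nlinarith
    · refine Int.floor_le_iff.2 ?_
      push_cast
      nlinarith
  let rep : (Fin n → ℤ) → Option (EuclideanSpace ℝ (Fin n)) := fun k =>
    if h : ∃ u : EuclideanSpace ℝ (Fin n), ‖u‖ = 1 ∧ cell u = k then some h.choose else none
  have hrep : ∀ k u, rep k = some u → ‖u‖ = 1 ∧ cell u = k := by
    intro k u hu
    simp only [rep] at hu
    split_ifs at hu with h
    · obtain rfl := Option.some.inj hu
      exact h.choose_spec
  refine ⟨keys.biUnion fun k => (rep k).toFinset, ?_, ?_, ?_⟩
  · intro u hu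
    obtain ⟨k, -, hk⟩ := Finset.mem_biUnion.1 hu
    exact (hrep k u (Option.mem_toFinset.1 hk)).1
  · refine (Finset.card_biUnion_le_card_mul _ _ 1 fun k _ => ?_).trans (le_of_eq ?_)
    · cases rep k <;> simp
    · simp only [keys, Fintype.card_piFinset, Finset.prod_const, Int.card_Icc, Finset.card_univ,
        Fintype.card_fin, mul_one]
      congr 1
      omega
  · intro u hu
    have hex : ∃ w : EuclideanSpace ℝ (Fin n), ‖w‖ = 1 ∧ cell w = cell u := ⟨u, hu, rfl⟩
    have hs : rep (cell u) = some hex.choose := by simp only [rep]; rw [dif_pos hex]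
    refine ⟨hex.choose, Finset.mem_biUnion.2 ⟨cell u, hkey u hu, by simp [hs]⟩, ?_⟩
    have hc := hex.choose_spec.2
    set w := hex.choose
    have hcoord : ∀ j, (u j - w j) ^ 2 ≤ (1 / M : ℝ) ^ 2 := by
      intro j
      have h1 : ⌊w j * M⌋ = ⌊u j * M⌋ := congrFun hc j
      have h2 := Int.abs_sub_lt_one_of_floor_eq_floor h1
      rw [← sub_mul, abs_mul, abs_of_pos hM', ← lt_div_iff₀ hM', abs_sub_comm] at h2
      exact sq_le_sq' (by linarith [(abs_lt.1 h2).1]) (abs_lt.1 h2).2.le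
    have h3 : ‖u - w‖ ^ 2 ≤ (n / M : ℝ) ^ 2 := by
      rw [EuclideanSpace.real_norm_sq_eq]
      calc ∑ j, (u - w) j ^ 2 ≤ ∑ _j : Fin n, (1 / M : ℝ) ^ 2 :=
            Finset.sum_le_sum fun j _ => hcoord j
        _ = n * (1 / M : ℝ) ^ 2 := by simp
        _ ≤ (n : ℝ) ^ 2 * (1 / M : ℝ) ^ 2 := by
            refine mul_le_mul_of_nonneg_right ?_ (by positivity)
            exact_mod_cast Nat.le_self_pow two_ne_zero n
        _ = (n / M : ℝ) ^ 2 := by ring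
    exact le_of_sq_le_sq h3 (by positivity)

/-! ### Sample quantiles and counting -/

theorem sampleQuantile_le {m : ℕ} (hm : 0 < m) {X : Fin m → ℝ} {p T : ℝ} (hp : 0 < p)
    (h : ((Finset.univ.filter fun i => T < X i).card : ℝ) ≤ (1 - p) * m) :
    sampleQuantile X p ≤ T := by
  have hm' : (0 : ℝ) < m := by exact_mod_cast hm
  have hcard : ((Finset.univ.filter fun i => X i ≤ T).card : ℝ) +
      (Finset.univ.filter fun i => T < X i).card = m := by
    have := Finset.card_filter_add_card_filter_not (s := (Finset.univ : Finset (Fin m)))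
      (fun i => X i ≤ T)
    simp only [not_le, Finset.card_univ, Fintype.card_fin] at this
    exact_mod_cast this
  refine csInf_le ?_ ?_
  -- `p > 0` keeps the level set above the smallest sample, so its infimum is genuine.
  · obtain ⟨b, hb⟩ := (Set.finite_range X).bddBelow
    refine ⟨b, fun x hx => ?_⟩
    by_contra hlt
    have hx' : p ≤ empiricalCDF X x := hx
    have h0 : (Finset.univ.filter fun i : Fin m => X i ≤ x) = ∅ := by
      refine Finset.filter_eq_empty_iff.2 fun i _ hi => ?_
      exact hlt ((hb ⟨i, rfl⟩).trans hi)
    rw [empiricalCDF, h0] at hx'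
    simp at hx'
    linarith
  · change p ≤ empiricalCDF X T
    rw [empiricalCDF, le_div_iff₀ hm']
    linarith

theorem le_sampleQuantile {m : ℕ} (hm : 0 < m) {X : Fin m → ℝ} {p T : ℝ} (hp : p ≤ 1)
    (h : ((Finset.univ.filter fun i => X i < T).card : ℝ) < p * m) :
    T ≤ sampleQuantile X p := by
  have hm' : (0 : ℝ) < m := by exact_mod_cast hm
  refine le_csInf ?_ ?_
  -- The level set must be nonempty, since `sInf ∅ = 0`; `p ≤ 1` ensures this.
  · obtain ⟨b, hb⟩ := (Set.finite_range X).bddAbove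
    refine ⟨b, ?_⟩
    change p ≤ empiricalCDF X b
    have h1 : (Finset.univ.filter fun i : Fin m => X i ≤ b) = Finset.univ :=
      Finset.filter_true_of_mem fun i _ => hb ⟨i, rfl⟩
    rw [empiricalCDF, h1, Finset.card_univ, Fintype.card_fin, div_self hm'.ne']
    exact hp
  · intro x hx
    by_contra hlt
    have hx' : p ≤ empiricalCDF X x := hx
    rw [empiricalCDF, le_div_iff₀ hm'] at hx'
    have hle : (Finset.univ.filter fun i => X i ≤ x).card ≤
        (Finset.univ.filter fun i => X i < T).card :=
      Finset.card_le_card fun i hi => by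
        simp only [Finset.mem_filter, Finset.mem_univ, true_and] at hi ⊢
        exact hi.trans_lt (not_le.1 hlt)
    have : ((Finset.univ.filter fun i => X i ≤ x).card : ℝ) ≤
        (Finset.univ.filter fun i => X i < T).card := by exact_mod_cast hle
    linarith

/-! ### The good event -/

open scoped Classical in
/-- The uniform control of products of two linear forms of the samples `a i` that yields the bounds
on the quantiles. -/
def ProductFrequencyBounds {m n : ℕ} (a : Fin m → EuclideanSpace ℝ (Fin n)) : Prop :=
  ∀ u v : EuclideanSpace ℝ (Fin n), ‖u‖ = 1 → ‖v‖ = 1 →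
    ((Finset.univ.filter fun i => 11 / 23 < |inner ℝ (a i) u * inner ℝ (a i) v|).card : ℝ) <
        0.48995 * m ∧
      ((Finset.univ.filter fun i => |inner ℝ (a i) u * inner ℝ (a i) v| ≤ 0.3147).card : ℝ) <
        0.48995 * m

theorem abs_inner_mul_inner_sub_le {E : Type*} [NormedAddCommGroup E] [InnerProductSpace ℝ E]
    (a : E) {u v u₀ v₀ : E} (hv : ‖v‖ = 1) (hu₀ : ‖u₀‖ = 1) {r : ℝ} (hu : ‖u - u₀‖ ≤ r)
    (hv₀ : ‖v - v₀‖ ≤ r) :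
    |inner ℝ a u * inner ℝ a v - inner ℝ a u₀ * inner ℝ a v₀| ≤ ‖a‖ ^ 2 * (2 * r) := by
  have e : (inner ℝ a u * inner ℝ a v - inner ℝ a u₀ * inner ℝ a v₀ : ℝ) =
      inner ℝ a (u - u₀) * inner ℝ a v + inner ℝ a u₀ * inner ℝ a (v - v₀) := by
    rw [inner_sub_right, inner_sub_right]
    ring
  have h1 : |(inner ℝ a (u - u₀) : ℝ)| ≤ ‖a‖ * r := (abs_real_inner_le_norm _ _).trans (by gcongr)
  have h2 : |(inner ℝ a v : ℝ)| ≤ ‖a‖ := by simpa [hv] using abs_real_inner_le_norm a v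
  have h3 : |(inner ℝ a u₀ : ℝ)| ≤ ‖a‖ := by simpa [hu₀] using abs_real_inner_le_norm a u₀
  have h4 : |(inner ℝ a (v - v₀) : ℝ)| ≤ ‖a‖ * r := (abs_real_inner_le_norm _ _).trans (by gcongr)
  rw [e]
  refine (abs_add_le _ _).trans ?_
  rw [abs_mul, abs_mul]
  have hr : 0 ≤ ‖a‖ * r := (abs_nonneg _).trans h1
  have := mul_le_mul h1 h2 (abs_nonneg _) hr
  have := mul_le_mul h3 h4 (abs_nonneg _) (norm_nonneg a)
  nlinarith

-- Rows with `‖a i‖² ≤ K` change the product by at most `0.00026` when `u`, `v` move to net points,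
-- and this fits both gaps: `0.478 + 0.00026 < 11/23` and `0.3147 + 0.00026 < 0.315`. The remaining
-- rows cost `0.0001 * m`, the step from `0.48985` to `0.48995`.
open scoped Classical in
theorem productFrequencyBounds_of_net {m n : ℕ} {a : Fin m → EuclideanSpace ℝ (Fin n)}
    {T : Finset (EuclideanSpace ℝ (Fin n))} {K r : ℝ} (hT : ∀ u ∈ T, ‖u‖ = 1)
    (hnet : ∀ u : EuclideanSpace ℝ (Fin n), ‖u‖ = 1 → ∃ u₀ ∈ T, ‖u - u₀‖ ≤ r)
    (hr : 0 ≤ r) (hKr : K * (2 * r) ≤ 0.00026)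
    (h₁ : ∀ u ∈ T, ∀ v ∈ T,
      ((Finset.univ.filter fun i => 0.478 < |inner ℝ (a i) u * inner ℝ (a i) v|).card : ℝ) <
        0.48985 * m)
    (h₂ : ∀ u ∈ T, ∀ v ∈ T,
      ((Finset.univ.filter fun i => |inner ℝ (a i) u * inner ℝ (a i) v| ≤ 0.315).card : ℝ) <
        0.48985 * m)
    (h₃ : ((Finset.univ.filter fun i => K < ‖a i‖ ^ 2).card : ℝ) < 0.0001 * m) :
    ProductFrequencyBounds a := by
  intro u v hu hv
  obtain ⟨u₀, hu₀, huu⟩ := hnet u hu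
  obtain ⟨v₀, hv₀, hvv⟩ := hnet v hv
  have hd : ∀ i, ‖a i‖ ^ 2 ≤ K →
      |(inner ℝ (a i) u * inner ℝ (a i) v - inner ℝ (a i) u₀ * inner ℝ (a i) v₀ : ℝ)| ≤
        0.00026 := by
    intro i hi
    refine (abs_inner_mul_inner_sub_le (a i) hv (hT u₀ hu₀) huu hvv).trans (le_trans ?_ hKr)
    gcongr
  have hcard : ∀ A B : Finset (Fin m), A ⊆ B ∪ Finset.univ.filter (fun i => K < ‖a i‖ ^ 2) →
      (B.card : ℝ) < 0.48985 * m → (A.card : ℝ) < 0.48995 * m := by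
    intro A B hAB hB
    have h := (Finset.card_le_card hAB).trans (Finset.card_union_le _ _)
    have h' : (A.card : ℝ) ≤ B.card + (Finset.univ.filter fun i => K < ‖a i‖ ^ 2).card := by
      exact_mod_cast h
    norm_num at hB h₃ ⊢
    linarith
  constructor
  · refine hcard _ _ ?_ (h₁ u₀ hu₀ v₀ hv₀)
    intro i hi
    simp only [Finset.mem_union, Finset.mem_filter, Finset.mem_univ, true_and] at hi ⊢
    by_contra! hcon
    have h := (abs_sub_abs_le_abs_sub _ _).trans (hd i hcon.2)
    have h' := hcon.1
    norm_num [-abs_mul] at h h'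
    linarith
  · refine hcard _ _ ?_ (h₂ u₀ hu₀ v₀ hv₀)
    intro i hi
    simp only [Finset.mem_union, Finset.mem_filter, Finset.mem_univ, true_and] at hi ⊢
    by_contra! hcon
    have h := hd i hcon.2
    rw [abs_sub_comm] at h
    have h := (abs_sub_abs_le_abs_sub _ _).trans h
    have h' := hcon.1
    norm_num [-abs_mul] at h h' hi
    linarith

open scoped Classical in
theorem IsIIDStdGaussianEntries.measureReal_not_productFrequencyBounds_le {Ω : Type*}
    [MeasurableSpace Ω] {P : Measure Ω} [IsProbabilityMeasure P] {m n : ℕ}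
    {a : Fin m → Ω → EuclideanSpace ℝ (Fin n)} (h : IsIIDStdGaussianEntries P a) (hn : 0 < n) :
    P.real {ω | ¬ ProductFrequencyBounds fun i => a i ω} ≤
      3 * (5 * 10 ^ 8 * (n : ℝ) ^ 2) ^ (2 * n) * Real.exp (-(5e-9 * m)) := by
  have hn1 : (1 : ℝ) ≤ n := by exact_mod_cast hn
  -- The net has radius `r = 1 / (2 · 10⁸ n)`; with `K = 20000 n` this makes `2 K r = 0.0002`.
  obtain ⟨T, hT, hcard, hnet⟩ := exists_sphere_net n (2 * 10 ^ 8 * n ^ 2) (by positivity)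
  have hI := h.iIndepFun_rows
  have hL := h.hasLaw_row
  let E₁ : EuclideanSpace ℝ (Fin n) → EuclideanSpace ℝ (Fin n) → Set Ω := fun u v =>
    {ω | (0.4898 + 0.00005 : ℝ) * m ≤ (Finset.univ.filter fun i =>
      a i ω ∈ {x | 0.478 < |inner ℝ x u * inner ℝ x v|}).card}
  let E₂ : EuclideanSpace ℝ (Fin n) → EuclideanSpace ℝ (Fin n) → Set Ω := fun u v =>
    {ω | (0.4898 + 0.00005 : ℝ) * m ≤ (Finset.univ.filter fun i =>
      a i ω ∈ {x | |inner ℝ x u * inner ℝ x v| ≤ 0.315}).card}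
  let E₃ : Set Ω := {ω | (1 / 20000 + 0.00005 : ℝ) * m ≤ (Finset.univ.filter fun i =>
      a i ω ∈ {x | 20000 * n < ‖x‖ ^ 2}).card}
  set δ : ℝ := Real.exp (-(5e-9 * m)) with hδ
  -- Every Hoeffding bound uses the deviation `ε = 0.00005`, and `2 ε² = 5 · 10⁻⁹`.
  have hexp : Real.exp (-(2 * (0.00005 : ℝ) ^ 2 * m)) = δ := by rw [hδ]; norm_num
  have b₁ : ∀ u ∈ T, ∀ v ∈ T, P.real (E₁ u v) ≤ δ := fun u hu v hv => hexp ▸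
    measureReal_card_ge_le hI hL (measurableSet_lt measurable_const (by fun_prop))
      (stdGaussian_abs_inner_mul_inner_gt_le (hT u hu) (hT v hv)) (by norm_num)
  have b₂ : ∀ u ∈ T, ∀ v ∈ T, P.real (E₂ u v) ≤ δ := fun u hu v hv => hexp ▸
    measureReal_card_ge_le hI hL (measurableSet_le (by fun_prop) measurable_const)
      (stdGaussian_abs_inner_mul_inner_le_le (hT u hu) (hT v hv)) (by norm_num)
  have b₃ : P.real E₃ ≤ δ := hexp ▸
    measureReal_card_ge_le hI hL (measurableSet_lt measurable_const (by fun_prop))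
      (stdGaussian_norm_sq_gt_le hn (by norm_num)) (by norm_num)
  have hsub : {ω | ¬ ProductFrequencyBounds fun i => a i ω} ⊆
      (⋃ w ∈ T ×ˢ T, (E₁ w.1 w.2 ∪ E₂ w.1 w.2)) ∪ E₃ := by
    intro ω hω
    by_contra hcon
    simp only [Set.mem_union, Set.mem_iUnion, not_or, not_exists, Finset.mem_product] at hcon
    refine hω (productFrequencyBounds_of_net (K := 20000 * n) hT hnet (by positivity) ?_ ?_ ?_ ?_)
    · push_cast
      field_simp
      norm_num
    · intro u hu v hv
      have := (hcon.1 (u, v) ⟨hu, hv⟩).1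
      simp only [E₁, Set.mem_ofPred_eq, not_le] at this
      norm_num at this ⊢
      exact this
    · intro u hu v hv
      have := (hcon.1 (u, v) ⟨hu, hv⟩).2
      simp only [E₂, Set.mem_ofPred_eq, not_le] at this
      norm_num at this ⊢
      exact this
    · have := hcon.2
      simp only [E₃, Set.mem_ofPred_eq, not_le] at this
      norm_num at this ⊢
      exact this
  have hδ0 : 0 < δ := Real.exp_pos _
  have hunion : P.real (⋃ w ∈ T ×ˢ T, (E₁ w.1 w.2 ∪ E₂ w.1 w.2)) ≤ (T.card : ℝ) ^ 2 * (2 * δ) := by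
    refine (measureReal_biUnion_finset_le _ _).trans ?_
    calc ∑ w ∈ T ×ˢ T, P.real (E₁ w.1 w.2 ∪ E₂ w.1 w.2) ≤ ∑ _w ∈ T ×ˢ T, 2 * δ := by
          refine Finset.sum_le_sum fun w hw => ?_
          obtain ⟨h1, h2⟩ := Finset.mem_product.1 hw
          have := measureReal_union_le (μ := P) (E₁ w.1 w.2) (E₂ w.1 w.2)
          linarith [b₁ _ h1 _ h2, b₂ _ h1 _ h2]
      _ = (T.card : ℝ) ^ 2 * (2 * δ) := by
          rw [Finset.sum_const, Finset.card_product, nsmul_eq_mul]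
          push_cast
          ring
  have hc : (T.card : ℝ) ≤ (5 * 10 ^ 8 * (n : ℝ) ^ 2) ^ n := by
    have h1 : (T.card : ℝ) ≤ (2 * (2 * 10 ^ 8 * n ^ 2) + 1) ^ n := by exact_mod_cast hcard
    refine h1.trans (pow_le_pow_left₀ (by positivity) ?_ n)
    nlinarith
  have hc2 : (T.card : ℝ) ^ 2 ≤ (5 * 10 ^ 8 * (n : ℝ) ^ 2) ^ (2 * n) := by
    rw [mul_comm 2 n, pow_mul]
    exact pow_le_pow_left₀ (by positivity) hc 2
  have hc3 : (1 : ℝ) ≤ (5 * 10 ^ 8 * (n : ℝ) ^ 2) ^ (2 * n) := one_le_pow₀ (by nlinarith)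
  have hfin := (measureReal_mono (μ := P) hsub).trans (measureReal_union_le _ _)
  nlinarith

/-- For `n ≥ 2` the factor `25 · 10¹⁶` is below `2 ^ 58 ≤ n ^ 58`. For `n = 1` the logarithm
vanishes, and the prefactor `3 · 10¹⁷` takes over. -/
theorem net_card_bound {n : ℕ} (hn : 0 < n) :
    (5 * 10 ^ 8 * (n : ℝ) ^ 2) ^ (2 * n) ≤
      3 * 10 ^ 17 * Real.exp (62 * (n * Real.log n)) := by
  have hn' : (0 : ℝ) < n := by exact_mod_cast hn
  have he : Real.exp (62 * (n * Real.log n)) = ((n : ℝ) ^ 62) ^ n := by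
    rw [← pow_mul, ← Real.exp_log (pow_pos hn' _), Real.log_pow]
    congr 1
    push_cast
    ring
  rw [he]
  rcases Nat.lt_or_ge 1 n with h | h
  · have h2 : (2 : ℝ) ≤ n := by exact_mod_cast h
    have h3 : (2 : ℝ) ^ 58 ≤ (n : ℝ) ^ 58 := pow_le_pow_left₀ (by norm_num) h2 58
    have h4 : (5 * 10 ^ 8 * (n : ℝ) ^ 2) ^ (2 * n) ≤ ((n : ℝ) ^ 62) ^ n := by
      rw [pow_mul]
      refine pow_le_pow_left₀ (by positivity) ?_ n
      have : (n : ℝ) ^ 62 = (n : ℝ) ^ 58 * (n : ℝ) ^ 4 := by ring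
      rw [this]
      have h5 : (0 : ℝ) ≤ (n : ℝ) ^ 4 := by positivity
      nlinarith
    have h6 : 0 ≤ ((n : ℝ) ^ 62) ^ n := by positivity
    linarith
  · obtain rfl : n = 1 := by omega
    norm_num

/-! ### From the good event to the quantiles -/

open scoped Classical in
theorem ProductFrequencyBounds.quantile_bounds {m n : ℕ} (hm : 0 < m)
    {a : Fin m → EuclideanSpace ℝ (Fin n)} (h : ProductFrequencyBounds a)
    {x z : EuclideanSpace ℝ (Fin n)} (hxz : ‖z - x‖ < 1 / 11 * ‖z‖) {p : ℝ} (hp1 : 0.49 ≤ p)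
    (hp2 : p ≤ 0.51) :
    0.6 * ‖z‖ * ‖z - x‖ ≤
        sampleQuantile (fun i => |(|inner ℝ (a i) x| ^ 2 - |inner ℝ (a i) z| ^ 2)|) p ∧
      sampleQuantile (fun i => |(|inner ℝ (a i) x| ^ 2 - |inner ℝ (a i) z| ^ 2)|) p ≤
        ‖z‖ * ‖z - x‖ := by
  have hm' : (0 : ℝ) < m := by exact_mod_cast hm
  have hp3 : 0 < p := by norm_num at hp1; linarith
  have hp4 : p ≤ 1 := by norm_num at hp2; linarith
  -- For `x = z` the direction `z - x` cannot be normalised, but all samples and both bounds are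
  -- `0`.
  rcases eq_or_ne (z - x) 0 with hzx | hzx
  · have hx : x = z := (sub_eq_zero.1 hzx).symm
    subst hx
    simp only [sub_self, norm_zero, mul_zero, abs_zero]
    refine ⟨le_sampleQuantile hm hp4 ?_, sampleQuantile_le hm hp3 ?_⟩
    · simpa using mul_pos hp3 hm'
    · simpa using mul_nonneg (sub_nonneg.2 hp4) hm'.le
  have hh : 0 < ‖z - x‖ := norm_pos_iff.2 hzx
  have hz : 0 < ‖z‖ := by linarith
  have hs1 : 21 / 11 * ‖z‖ ≤ ‖z + x‖ := by
    have h1 : ‖(2 : ℝ) • z‖ ≤ ‖z + x‖ + ‖z - x‖ := by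
      have e : (2 : ℝ) • z = (z + x) + (z - x) := by module
      rw [e]
      exact norm_add_le _ _
    rw [norm_smul, Real.norm_ofNat] at h1
    linarith
  have hs2 : ‖z + x‖ ≤ 23 / 11 * ‖z‖ := by
    have e : z + x = (2 : ℝ) • z - (z - x) := by module
    have h1 := norm_sub_le ((2 : ℝ) • z) (z - x)
    rw [← e, norm_smul, Real.norm_ofNat] at h1
    linarith
  have hs : 0 < ‖z + x‖ := by linarith
  obtain ⟨hb1, hb2⟩ := h (‖z - x‖⁻¹ • (z - x)) (‖z + x‖⁻¹ • (z + x))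
    (by rw [norm_smul, norm_inv, norm_norm, inv_mul_cancel₀ hh.ne'])
    (by rw [norm_smul, norm_inv, norm_norm, inv_mul_cancel₀ hs.ne'])
  have hX : ∀ i, |(|inner ℝ (a i) x| ^ 2 - |inner ℝ (a i) z| ^ 2 : ℝ)| =
      ‖z - x‖ * ‖z + x‖ * |inner ℝ (a i) (‖z - x‖⁻¹ • (z - x)) *
        inner ℝ (a i) (‖z + x‖⁻¹ • (z + x))| := by
    intro i
    rw [← abs_of_pos (mul_pos hh hs), ← abs_mul, sq_abs, sq_abs, abs_sub_comm, inner_smul_right,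
      inner_smul_right, inner_sub_right, inner_add_right]
    congr 1
    field_simp
    ring
  simp only [hX]
  constructor
  · refine le_sampleQuantile hm hp4 (lt_of_le_of_lt ?_ (hb2.trans_le ?_))
    · refine Nat.cast_le.2 (Finset.card_le_card fun i hi => ?_)
      simp only [Finset.mem_filter, Finset.mem_univ, true_and] at hi ⊢
      set w := |(inner ℝ (a i) (‖z - x‖⁻¹ • (z - x)) * inner ℝ (a i) (‖z + x‖⁻¹ • (z + x)) : ℝ)|
      have hw : 0 ≤ w := abs_nonneg _
      have h1 : ‖z + x‖ * w < 0.6 * ‖z‖ := by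
        refine lt_of_mul_lt_mul_left (a := ‖z - x‖) ?_ hh.le
        linarith
      have h2 := mul_le_mul_of_nonneg_right hs1 hw
      have h3 : 21 / 11 * w < 0.6 := by
        refine lt_of_mul_lt_mul_left (a := ‖z‖) ?_ hz.le
        linarith
      norm_num at h3 ⊢
      linarith
    · norm_num at hp1 ⊢
      nlinarith
  · refine sampleQuantile_le hm hp3 (le_trans ?_ (hb1.le.trans ?_))
    · refine Nat.cast_le.2 (Finset.card_le_card fun i hi => ?_)
      simp only [Finset.mem_filter, Finset.mem_univ, true_and] at hi ⊢
      set w := |(inner ℝ (a i) (‖z - x‖⁻¹ • (z - x)) * inner ℝ (a i) (‖z + x‖⁻¹ • (z + x)) : ℝ)|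
      have hw : 0 ≤ w := abs_nonneg _
      have h1 : ‖z‖ < ‖z + x‖ * w := by
        refine lt_of_mul_lt_mul_left (a := ‖z - x‖) ?_ hh.le
        linarith
      have h2 := mul_le_mul_of_nonneg_right hs2 hw
      have h3 : 1 < 23 / 11 * w := by
        refine lt_of_mul_lt_mul_left (a := ‖z‖) ?_ hz.le
        linarith
      linarith
    · norm_num at hp2 ⊢
      nlinarith

/-- There are universal constants `c₀, c₁, c₂ > 0` such that if `m > c₀ n log n`, then on an event
`G` of probability at least `1 - c₁ exp (-c₂ m)` the three sample quantiles are sandwiched,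
simultaneously for all `x`, `z` with `‖z - x‖ < ‖z‖ / 11`. -/
theorem proposition3 :
    ∃ c₀ c₁ c₂ : ℝ, 0 < c₀ ∧ 0 < c₁ ∧ 0 < c₂ ∧
      ∀ (m n : ℕ), c₀ * ((n : ℝ) * Real.log (n : ℝ)) < (m : ℝ) →
      ∀ (Ω : Type*) [MeasurableSpace Ω] (P : Measure Ω) [IsProbabilityMeasure P]
        (a : Fin m → Ω → EuclideanSpace ℝ (Fin n)),
        IsIIDStdGaussianEntries P a →
        ∃ G : Set Ω, MeasurableSet G ∧
          1 - c₁ * Real.exp (-(c₂ * (m : ℝ))) ≤ P.real G ∧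
          ∀ ω ∈ G, ∀ x z : EuclideanSpace ℝ (Fin n), ‖z - x‖ < 1 / 11 * ‖z‖ →
            ∀ p ∈ ({0.49, 0.5, 0.51} : Set ℝ),
              0.6 * ‖z‖ * ‖z - x‖ ≤
                  sampleQuantile
                    (fun i => |(|inner ℝ (a i ω) x| ^ 2 - |inner ℝ (a i ω) z| ^ 2)|) p ∧
                sampleQuantile
                    (fun i => |(|inner ℝ (a i ω) x| ^ 2 - |inner ℝ (a i ω) z| ^ 2)|) p ≤
                  ‖z‖ * ‖z - x‖ := by
  -- `c₀` makes `62 n log n ≤ 4 · 10⁻⁹ m`, so `10⁻⁹ m` of the Hoeffding exponent `5 · 10⁻⁹ m`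
  -- survives; `c₁ = 3 · (3 · 10¹⁷)`.
  refine ⟨2 * 10 ^ 10, 9 * 10 ^ 17, 1e-9, by norm_num, by norm_num, by norm_num, ?_⟩
  intro m n hmn Ω _ P _ a ha
  rcases Nat.eq_zero_or_pos n with rfl | hn
  -- In dimension `0` the strict inequality on `‖z - x‖` reads `0 < 0`.
  · refine ⟨Set.univ, MeasurableSet.univ, ?_, fun ω _ x z hxz => ?_⟩
    · rw [probReal_univ]
      linarith [Real.exp_pos (-(1e-9 * (m : ℝ)))]
    · rw [Subsingleton.elim z 0, Subsingleton.elim x 0] at hxz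
      simp at hxz
  have hn1 : (1 : ℝ) ≤ n := by exact_mod_cast hn
  have hlog : 0 ≤ (n : ℝ) * Real.log n := mul_nonneg (by linarith) (Real.log_nonneg hn1)
  have hm : 0 < m := by
    have : (0 : ℝ) < m := lt_of_le_of_lt (by positivity) hmn
    exact_mod_cast this
  set B : Set Ω := {ω | ¬ ProductFrequencyBounds fun i => a i ω} with hB
  -- The bad set is defined through uncountably many `u`, `v`; passing to a measurable hull of equal
  -- measure avoids proving it measurable.
  refine ⟨(toMeasurable P B)ᶜ, (measurableSet_toMeasurable P B).compl, ?_, ?_⟩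
  · rw [probReal_compl_eq_one_sub (measurableSet_toMeasurable P B)]
    have hB1 : P.real (toMeasurable P B) = P.real B := by
      rw [measureReal_def, measureReal_def, measure_toMeasurable]
    have hB2 := ha.measureReal_not_productFrequencyBounds_le hn
    have hB3 := mul_le_mul_of_nonneg_right (net_card_bound hn) (Real.exp_pos (-(5e-9 * (m : ℝ)))).le
    have hB4 : Real.exp (62 * (n * Real.log n)) * Real.exp (-(5e-9 * (m : ℝ))) ≤
        Real.exp (-(1e-9 * (m : ℝ))) := by
      rw [← Real.exp_add, Real.exp_le_exp]
      norm_num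
      linarith
    rw [hB1]
    nlinarith
  · intro ω hω x z hxz p hp
    have hgood : ProductFrequencyBounds fun i => a i ω := by
      by_contra hcon
      exact hω (subset_toMeasurable P B hcon)
    have hp' : 0.49 ≤ p ∧ p ≤ 0.51 := by
      rcases hp with rfl | rfl | rfl <;> norm_num
    exact hgood.quantile_bounds hm hxz hp'.1 hp'.2
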